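/- Let $(X,d_X)$ be a compact metric space, $(\Omega,d)$ a Polish metric space, $A\subset\Omega$ compact, and let $\mu$ be a fully supported Borel probability measure on $X\times A$. Let $p\ge 1$ and $\alpha\in[0,1]$. For probability measures $\mu_1$ on $X\times A$ and $\mu_2$ on $Y\times B$ (where $(Y,d_Y)$ is a compact metric space and $B\subset\Omega$ is compact) put $$d_{FGW,\alpha,p,1}(\mu_1,\mu_2)=\Big(\inf_{\pi}\iint\big((1-\alpha)\,d(a,b)+\alpha\,|d_X(x,x')-d_Y(y,y')|\big)^p\,d\pi((x,a),(y,b))\,d\pi((x',a'),(y',b'))\Big)^{1/p},$$ where $\pi$ ranges over the couplings of $\mu_1$ and $\mu_2$. Similarly, for probability measures $\nu_1$ on $X$ and $\nu_2$ on $Y$, $$d_{GW,p}(\nu_1,\nu_2)=\Big(\inf_{\pi}\iint|d_X(x,x')-d_Y(y,y')|^p\,d\pi(x,y)\,d\pi(x',y')\Big)^{1/p}.$$ For a Borel probability measure $\rho$ on a Polish metric space, let $N_\epsilon(S)$ be the least number of closed balls of diameter $\epsilon$ (that is, of radius $\epsilon/2$) covering $S$, let $N_{\epsilon,\tau}(\rho)=\inf\{N_\epsilon(S):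 S \text{ Borel},\ \rho(S)\ge 1-\tau\}$ and $\dim_\epsilon(\rho,\tau)=\frac{\log N_{\epsilon,\tau}(\rho)}{-\log\epsilon}$. The upper Wasserstein dimension of $\rho$ is $$d_p^*(\rho)=\inf\Big\{s\in(2p,\infty):\ \limsup_{\epsilon\to0^+}\dim_\epsilon\big(\rho,\epsilon^{\frac{sp}{s-2p}}\big)\le s\Big\}\in[2p,\infty].$$ For $\mu$ it is taken with respect to the metric $d_X\oplus d\,((x,a),(x',a'))=d_X(x,x')+d(a,a')$ on $X\times A$. 1. (Convergence.) Let $(x_i,a_i)_{i\ge1}$ be i.i.d. with law $\mu$, and let $\mu_n=\frac1n\sum_{i=1}^n\delta_{(x_i,a_i)}$. Then, almost surely, $\lim_{n\to\infty}d_{FGW,\alpha,p,1}(\mu_n,\mu)=0$. 2. (Rate.) If $s>d_p^*(\mu)$, there is a constant $C$, depending on $X,\Omega,A,\mu,\alpha,p,s$ but not on $n$ or on the choice of the i.i.d. sample, such that for all $n\ge1$ the function $d_{FGW,\alpha,p,1}(\mu_n,\mu)$ of the sample is measurable up to a null set and $$\mathbb E\big[d_{FGW,\alpha,p,1}(\mu_n,\mu)\big]\le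 C\,n^{-1/s}.$$ 3. (Gromov–Wasserstein rate.) Let $\nu$ be a fully supported Borel probability measure on $X$, and let $\nu_n=\frac1n\sum_{i=1}^n\delta_{x_i}$ with $(x_i)_{i\ge1}$ i.i.d. of law $\nu$. If $s'>d_p^*(\nu)$, there is a constant $C$, depending on $X,\nu,p,s'$ but not on $n$ or on the choice of the i.i.d. sample, such that for all $n\ge1$ the function $d_{GW,p}(\nu_n,\nu)$ of the sample is measurable up to a null set and $$\mathbb E\big[d_{GW,p}(\nu_n,\nu)\big]\le C\,n^{-1/s'}.$$ -/

import Mathlib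

open MeasureTheory ProbabilityTheory Filter Topology
open scoped ENNReal NNReal

noncomputable section

/-- The set of couplings of `μ` and `ν`: measures on the product with marginals `μ` and `ν`. -/
def couplings {E F : Type*} [MeasurableSpace E] [MeasurableSpace F]
    (μ : Measure E) (ν : Measure F) : Set (Measure (E × F)) :=
  {π | π.map Prod.fst = μ ∧ π.map Prod.snd = ν}

section FusedGromovWasserstein

variable {X Y Ω : Type*} [MetricSpace X] [MeasurableSpace X] [MetricSpace Y] [MeasurableSpace Y]
  [MetricSpace Ω] [MeasurableSpace Ω] {A B : Set Ω}

/-- The Fused Gromov-Wasserstein loss of a plan `π` on `(X × A) × (Y × B)`, where `A` and `B` are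
subsets of the common feature space `Ω`: the integral of
`((1 - α) d(a, b) ^ q + α |d_X(x, x') - d_Y(y, y')| ^ q) ^ p` with respect to
`π((x, a), (y, b)) ⊗ π((x', a'), (y', b'))`. -/
def fgwLoss (α p q : ℝ) (π : Measure ((X × A) × (Y × B))) : ℝ≥0∞ :=
  ∫⁻ w : ((X × A) × (Y × B)) × ((X × A) × (Y × B)),
    ENNReal.ofReal
      (((1 - α) * dist (w.1.1.2 : Ω) (w.1.2.2 : Ω) ^ q
        + α * |dist w.1.1.1 w.2.1.1 - dist w.1.2.1 w.2.2.1| ^ q) ^ p) ∂(π.prod π)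

/-- The Fused Gromov-Wasserstein distance between `μ` on `X × A` and `ν` on `Y × B`. -/
def fgwDist (α p q : ℝ) (μ : Measure (X × A)) (ν : Measure (Y × B)) : ℝ≥0∞ :=
  (⨅ π ∈ couplings μ ν, fgwLoss α p q π) ^ (1 / p)

/-- The Gromov-Wasserstein loss of a plan `π` on `X × Y`: the integral of
`|d_X(x, x') - d_Y(y, y')| ^ p` with respect to `π(x, y) ⊗ π(x', y')`. -/
def gwLoss (p : ℝ) (π : Measure (X × Y)) : ℝ≥0∞ :=
  ∫⁻ w : (X × Y) × (X × Y),
    ENNReal.ofReal (|dist w.1.1 w.2.1 - dist w.1.2 w.2.2| ^ p) ∂(π.prod π)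

/-- The Gromov-Wasserstein distance between `μ` on `X` and `ν` on `Y`. -/
def gwDist (p : ℝ) (μ : Measure X) (ν : Measure Y) : ℝ≥0∞ :=
  (⨅ π ∈ couplings μ ν, gwLoss p π) ^ (1 / p)

end FusedGromovWasserstein

section UpperWassersteinDimension

variable {E : Type*} [MetricSpace E] [MeasurableSpace E]

/-- `N_ε(S)`: the least number of closed balls of diameter `ε`, that is of radius `ε / 2`, with
centers anywhere in the space, which cover `S` (`⊤` if finitely many do not suffice). -/
def ballCoveringNumber (ε : ℝ) (S : Set E) : ℕ∞ :=
  Metric.externalCoveringNumber (ε / 2).toNNReal S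

/-- `N_{ε,τ}(μ)`: the least `N_ε(S)` over the measurable sets `S` with `μ(S) ≥ 1 - τ`. -/
def measureCoveringNumber (μ : Measure E) (ε τ : ℝ) : ℕ∞ :=
  ⨅ (S : Set E) (_ : MeasurableSet S) (_ : ENNReal.ofReal (1 - τ) ≤ μ S), ballCoveringNumber ε S

/-- `dim_ε(μ, τ) = log N_{ε,τ}(μ) / (-log ε)`, as an extended real number. -/
def measureCoveringDim (μ : Measure E) (ε τ : ℝ) : EReal :=
  ENNReal.log (measureCoveringNumber μ ε τ : ℝ≥0∞) / ((-Real.log ε : ℝ) : EReal)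

/-- The upper Wasserstein dimension `d_p^*(μ)`: the infimum (`⊤` if there is none) of the `s > 2p`
with `limsup_{ε → 0+} dim_ε(μ, ε ^ (s p / (s - 2 p))) ≤ s`. -/
def upperWassersteinDim (p : ℝ) (μ : Measure E) : EReal :=
  ⨅ (s : ℝ) (_ : 2 * p < s)
    (_ : limsup (fun ε : ℝ => measureCoveringDim μ ε (ε ^ (s * p / (s - 2 * p)))) (𝓝[>] 0)
      ≤ (s : EReal)), (s : EReal)

end UpperWassersteinDimension

section Samples

variable {E : Type*} [MeasurableSpace E]

/-- `Z 0, Z 1, …` is a sequence of independent random variables, each with law `μ`, on the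
probability space `(Θ, P)`. -/
structure IsIIDSample {Θ : Type*} [MeasurableSpace Θ] (P : Measure Θ) (μ : Measure E)
    (Z : ℕ → Θ → E) : Prop where
  measurable : ∀ i, Measurable (Z i)
  indep : iIndepFun Z P
  law : ∀ i, P.map (Z i) = μ

/-- The empirical measure `(1 / n) ∑_{i < n} δ_{z i}`. -/
def empiricalMeasure (z : ℕ → E) (n : ℕ) : Measure E :=
  (n : ℝ≥0∞)⁻¹ • ∑ i ∈ Finset.range n, Measure.dirac (z i)

end Samples

/-- A measure on `X × A` seen on the same space endowed with the sum metric
`d_X ⊕ d ((x, a), (x', a')) = d_X(x, x') + d(a, a')`. -/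
def onSumMetric {X A : Type*} [MeasurableSpace X] [MeasurableSpace A] (μ : Measure (X × A)) :
    Measure (WithLp 1 (X × A)) :=
  μ.map (WithLp.toLp 1)

end

/-! Everything reduces to the Wasserstein distance. Since `|d(x,x') - d(y,y')| ≤ d(x,y) + d(x',y')`,
the loss of any coupling `π` at a pair of points of its support is at most the `p`-th power of the
sum of the two displacements. Hence the FGW and GW distances are at most twice the Wasserstein
distance of order `p`, taken for the sum metric in the fused case (`fgwDist_rpow_le`,
`gwDist_rpow_le`).

The Wasserstein cost is bounded by a multiscale transport (`exists_coupling_of_refining`): match as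
much mass as possible inside the finest cells and pass what is left to coarser ones. The mass moved
at scale `4 ^ (-k)` is then the sum of the positive parts of `μ_n(Q) - μ(Q)` over the cells `Q` one
level finer. For convergence, one partition of small mesh and the strong law on its finitely many
cells suffice.

For the rate, the variance of `μ_n(Q)` is at most `μ(Q) / n`, so `N` cells contribute at most `√(N /
n)` in expectation, and all other cells at most their `μ`-mass. If `s` exceeds the upper Wasserstein
dimension, there are covers with `N` of order `ε ^ (-s)` missing mass at most `ε ^ (s p / (s - 2
p))`. As `s > 2 p`, the sum over scales is geometric, dominated by the finest scale `n ^ (-1 / s)`,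
and the cost has expectation of order `n ^ (-p / s)`. Jensen's inequality gives the exponent `-1 /
s`. -/

noncomputable section

/-! ### Hierarchical transport along nested partitions -/

section Transport

variable {E ι : Type*} [MeasurableSpace E]

theorem sum_measure_restrict_fiber (T : SimpleFunc E ι) (μ : Measure E) :
    ∑ c ∈ T.range, μ.restrict (T ⁻¹' {c}) = μ := by
  ext s hs
  rw [Measure.finsetSum_apply]
  simp_rw [Measure.restrict_apply hs]
  rw [← measure_biUnion_finset]
  · congr 1
    ext x
    simp
  · intro c _ c' _ hcc
    refine Set.disjoint_left.2 fun x hx hx' => hcc ?_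
    rw [← hx.2, ← hx'.2]
  · exact fun c _ => hs.inter (T.measurableSet_fiber c)

theorem measure_eq_sum_fiber (T : SimpleFunc E ι) (μ : Measure E) :
    μ Set.univ = ∑ c ∈ T.range, μ (T ⁻¹' {c}) := by
  conv_lhs => rw [← sum_measure_restrict_fiber T μ]
  simp [Measure.finsetSum_apply]

/-- Within each fibre of `T`, transport as much of `μ` onto `ν` as possible; `μ'` and `ν'` are what
is left of `μ` and `ν`. -/
theorem exists_fiberwise_coupling (T : SimpleFunc E ι) (μ ν : Measure E) [IsFiniteMeasure μ]
    [IsFiniteMeasure ν] :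
    ∃ (π : Measure (E × E)) (μ' ν' : Measure E),
      π.map Prod.fst + μ' = μ ∧ π.map Prod.snd + ν' = ν ∧ (∀ᵐ w ∂π, T w.1 = T w.2) ∧
      ∀ c ∈ T.range, μ' (T ⁻¹' {c}) = μ (T ⁻¹' {c}) - ν (T ⁻¹' {c}) := by
  classical
  set a : ι → ℝ≥0∞ := fun c => μ (T ⁻¹' {c}) with ha
  set b : ι → ℝ≥0∞ := fun c => ν (T ⁻¹' {c}) with hb
  have hat (c) : a c ≠ ⊤ := measure_ne_top _ _
  have hbt (c) : b c ≠ ⊤ := measure_ne_top _ _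
  have hmt (c) : max (a c) (b c) ≠ ⊤ := by simp [hat, hbt]
  have hma (c) : a c / max (a c) (b c) ≤ 1 := ENNReal.div_le_of_le_mul (by simp)
  have hmb (c) : b c / max (a c) (b c) ≤ 1 := ENNReal.div_le_of_le_mul (by simp)
  -- The product of the restrictions to a cell has marginals `b c • μ` and `a c • ν` there. Dividing
  -- by `max (a c) (b c)` keeps both below `μ` and `ν` and matches exactly the mass `min (a c) (b
  -- c)`.
  set π : Measure (E × E) := ∑ c ∈ T.range, (max (a c) (b c))⁻¹ •
    (μ.restrict (T ⁻¹' {c})).prod (ν.restrict (T ⁻¹' {c})) with hπ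
  refine ⟨π, ∑ c ∈ T.range, (1 - b c / max (a c) (b c)) • μ.restrict (T ⁻¹' {c}),
    ∑ c ∈ T.range, (1 - a c / max (a c) (b c)) • ν.restrict (T ⁻¹' {c}), ?_, ?_, ?_, ?_⟩
  · have : π.map Prod.fst = ∑ c ∈ T.range, (b c / max (a c) (b c)) • μ.restrict (T ⁻¹' {c}) := by
      rw [hπ, ← Measure.mapₗ_apply_of_measurable measurable_fst, map_sum]
      refine Finset.sum_congr rfl fun c _ => ?_
      rw [Measure.mapₗ_apply_of_measurable measurable_fst, Measure.map_smul, Measure.map_fst_prod,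
        smul_smul, Measure.restrict_apply_univ, mul_comm, div_eq_mul_inv]
    rw [this, ← Finset.sum_add_distrib]
    conv_rhs => rw [← sum_measure_restrict_fiber T μ]
    refine Finset.sum_congr rfl fun c _ => ?_
    rw [← add_smul, add_tsub_cancel_of_le (hmb c), one_smul]
  · have : π.map Prod.snd = ∑ c ∈ T.range, (a c / max (a c) (b c)) • ν.restrict (T ⁻¹' {c}) := by
      rw [hπ, ← Measure.mapₗ_apply_of_measurable measurable_snd, map_sum]
      refine Finset.sum_congr rfl fun c _ => ?_
      rw [Measure.mapₗ_apply_of_measurable measurable_snd, Measure.map_smul, Measure.map_snd_prod,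
        smul_smul, Measure.restrict_apply_univ, mul_comm, div_eq_mul_inv]
    rw [this, ← Finset.sum_add_distrib]
    conv_rhs => rw [← sum_measure_restrict_fiber T ν]
    refine Finset.sum_congr rfl fun c _ => ?_
    rw [← add_smul, add_tsub_cancel_of_le (hma c), one_smul]
  · rw [hπ, ae_finsetSum_measure_iff]
    intro c _
    refine Measure.ae_smul_measure ?_ _
    rw [Measure.prod_restrict]
    filter_upwards [ae_restrict_mem ((T.measurableSet_fiber c).prod (T.measurableSet_fiber c))]
      with w hw
    exact hw.1.trans hw.2.symm
  · intro c hc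
    rw [Measure.finsetSum_apply, Finset.sum_eq_single_of_mem c hc]
    · rw [Measure.smul_apply, Measure.restrict_apply (T.measurableSet_fiber c), Set.inter_self,
        smul_eq_mul, ENNReal.sub_mul (fun _ _ => hat c), one_mul]
      change a c - b c / max (a c) (b c) * a c = a c - b c
      rcases le_total (a c) (b c) with h | h
      · rw [max_eq_right h, tsub_eq_zero_of_le h]
        rcases eq_or_ne (b c) 0 with h0 | h0
        · simp [le_antisymm (h.trans h0.le) zero_le]
        · rw [ENNReal.div_self h0 (hbt c), one_mul, tsub_self]
      · rw [max_eq_left h]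
        rcases eq_or_ne (a c) 0 with h0 | h0
        · simp [h0]
        · rw [ENNReal.div_mul_cancel h0 (hat c)]
    · intro c' _ hcc
      rw [Measure.smul_apply, Measure.restrict_apply (T.measurableSet_fiber c)]
      have : T ⁻¹' {c} ∩ T ⁻¹' {c'} = ∅ := by
        ext x
        simp only [Set.mem_inter_iff, Set.mem_preimage, Set.mem_singleton_iff,
          Set.mem_empty_iff_false, iff_false, not_and]
        exact fun h h' => hcc (h'.symm.trans h)
      simp [this]

/-- Hierarchical transport along the nested partitions into the fibres of `T 0, T 1, …, T K`. -/
theorem exists_coupling_of_refining [EDist E] {T : ℕ → SimpleFunc E ι} {D : ℕ → ℝ≥0∞} {p : ℝ}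
    (hp : 0 ≤ p) (h0 : ∀ x y, T 0 x = T 0 y) (K : ℕ)
    (hT : ∀ k < K, ∀ x y, T (k + 1) x = T (k + 1) y → T k x = T k y)
    (hD : ∀ k ≤ K, ∀ x y, T k x = T k y → edist x y ≤ D k)
    (μ ν : Measure E) [IsFiniteMeasure μ] [IsFiniteMeasure ν] (hμν : μ Set.univ = ν Set.univ) :
    ∃ π ∈ couplings μ ν, ∫⁻ w, edist w.1 w.2 ^ p ∂π ≤ D K ^ p * μ Set.univ
      + ∑ k ∈ Finset.range K, D k ^ p *
        ∑ c ∈ (T (k + 1)).range, (μ (T (k + 1) ⁻¹' {c}) - ν (T (k + 1) ⁻¹' {c})) := by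
  induction K generalizing μ ν with
  | zero =>
    rcases eq_or_ne (μ Set.univ) 0 with hz | hz
    · have h1 := Measure.measure_univ_eq_zero.1 hz
      have h2 := Measure.measure_univ_eq_zero.1 (hμν ▸ hz)
      refine ⟨0, ⟨?_, ?_⟩, ?_⟩ <;> simp [h1, h2]
    · have ht : μ Set.univ ≠ ⊤ := measure_ne_top _ _
      refine ⟨(μ Set.univ)⁻¹ • μ.prod ν, ⟨?_, ?_⟩, ?_⟩
      · rw [Measure.map_smul, Measure.map_fst_prod, smul_smul, ← hμν, ENNReal.inv_mul_cancel hz ht,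
          one_smul]
      · rw [Measure.map_smul, Measure.map_snd_prod, smul_smul, ENNReal.inv_mul_cancel hz ht,
          one_smul]
      · calc ∫⁻ w, edist w.1 w.2 ^ p ∂((μ Set.univ)⁻¹ • μ.prod ν)
            ≤ ∫⁻ _, D 0 ^ p ∂((μ Set.univ)⁻¹ • μ.prod ν) :=
              lintegral_mono fun w => ENNReal.rpow_le_rpow (hD 0 le_rfl _ _ (h0 _ _)) hp
          _ ≤ _ := by
              rw [lintegral_const, Measure.smul_apply, ← Set.univ_prod_univ, Measure.prod_prod,
                smul_eq_mul, ← hμν, ← mul_assoc (μ Set.univ)⁻¹, ENNReal.inv_mul_cancel hz ht, one_mul]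
              simp
  | succ K ih =>
    obtain ⟨π, μ', ν', hμ', hν', hπ, hc⟩ := exists_fiberwise_coupling (T (K + 1)) μ ν
    have hμle : μ' ≤ μ := by rw [← hμ']; exact Measure.le_add_left le_rfl
    have hνle : ν' ≤ ν := by rw [← hν']; exact Measure.le_add_left le_rfl
    have : IsFiniteMeasure μ' := isFiniteMeasure_of_le μ hμle
    have : IsFiniteMeasure ν' := isFiniteMeasure_of_le ν hνle
    have hfle : π.map Prod.fst ≤ μ := by
      conv_rhs => rw [← hμ']
      exact Measure.le_add_right le_rfl
    have hfu : π.map Prod.fst Set.univ = π Set.univ := by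
      rw [Measure.map_apply measurable_fst MeasurableSet.univ, Set.preimage_univ]
    have hsu : π.map Prod.snd Set.univ = π Set.univ := by
      rw [Measure.map_apply measurable_snd MeasurableSet.univ, Set.preimage_univ]
    have hπle : π Set.univ ≤ μ Set.univ := hfu ▸ hfle _
    have : IsFiniteMeasure π := ⟨hπle.trans_lt (measure_lt_top _ _)⟩
    have hmass : μ' Set.univ = ν' Set.univ := by
      have h1 := congrArg (fun m => m Set.univ) hμ'
      have h2 := congrArg (fun m => m Set.univ) hν'
      simp only [Measure.add_apply, hfu, hsu] at h1 h2
      rw [← hμν, ← h1] at h2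
      exact (ENNReal.add_right_inj (measure_ne_top π _)).1 h2.symm
    have hcoarse : ∀ k ≤ K, ∀ x y, T (K + 1) x = T (K + 1) y → T k x = T k y := by
      intro k hk x y hxy
      induction hk using Nat.decreasingInduction with
      | self => exact hT K (Nat.lt_succ_self K) x y hxy
      | of_succ j hj ihj => exact hT j (hj.trans (Nat.lt_succ_self K)) x y ihj
    -- Mass matched inside a fine cell stays inside every coarser cell, so it is removed equally
    -- from both measures, and the coarse discrepancies of the leftovers are the original ones.
    have hdiff : ∀ k ≤ K, ∀ c, μ' (T k ⁻¹' {c}) - ν' (T k ⁻¹' {c})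
        = μ (T k ⁻¹' {c}) - ν (T k ⁻¹' {c}) := by
      intro k hk c
      have hm := (T k).measurableSet_fiber c
      have h1 : π.map Prod.fst (T k ⁻¹' {c}) = π.map Prod.snd (T k ⁻¹' {c}) := by
        rw [Measure.map_apply measurable_fst hm, Measure.map_apply measurable_snd hm]
        refine measure_congr ?_
        filter_upwards [hπ] with w hw
        have := hcoarse k hk _ _ hw
        simp only [eq_iff_iff]
        change T k w.1 = c ↔ T k w.2 = c
        rw [this]
      have h2 : π.map Prod.snd (T k ⁻¹' {c}) ≠ ⊤ := by
        rw [Measure.map_apply measurable_snd hm]; exact measure_ne_top _ _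
      conv_rhs => rw [← hμ', ← hν']
      rw [Measure.add_apply, Measure.add_apply, h1, ENNReal.add_sub_add_eq_sub_left h2]
    obtain ⟨π', ⟨hπ1, hπ2⟩, hle⟩ := ih (fun k hk => hT k (hk.trans (Nat.lt_succ_self K)))
      (fun k hk => hD k (hk.trans (Nat.le_succ K))) μ' ν' hmass
    refine ⟨π + π', ⟨?_, ?_⟩, ?_⟩
    · rw [Measure.map_add _ _ measurable_fst, hπ1, hμ']
    · rw [Measure.map_add _ _ measurable_snd, hπ2, hν']
    · rw [lintegral_add_measure, Finset.sum_range_succ]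
      have h1 : ∫⁻ w, edist w.1 w.2 ^ p ∂π ≤ D (K + 1) ^ p * μ Set.univ := by
        calc ∫⁻ w, edist w.1 w.2 ^ p ∂π ≤ ∫⁻ _, D (K + 1) ^ p ∂π := by
              refine lintegral_mono_ae ?_
              filter_upwards [hπ] with w hw
              exact ENNReal.rpow_le_rpow (hD (K + 1) le_rfl _ _ hw) hp
          _ ≤ _ := by rw [lintegral_const]; gcongr
      -- The leftover mass, charged `D K ^ p` by the induction hypothesis, is the level `K + 1`
      -- discrepancy: this is the new summand `k = K`.
      have h2 : μ' Set.univ = ∑ c ∈ (T (K + 1)).range,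
          (μ (T (K + 1) ⁻¹' {c}) - ν (T (K + 1) ⁻¹' {c})) := by
        rw [measure_eq_sum_fiber (T (K + 1)) μ']
        exact Finset.sum_congr rfl hc
      refine (add_le_add h1 hle).trans ?_
      rw [h2, add_comm (D K ^ p * _)]
      gcongr ?_ + (?_ + ?_)
      · rfl
      · refine Finset.sum_le_sum fun k hk => ?_
        simp_rw [hdiff (k + 1) (Finset.mem_range.1 hk)]
        rfl
      · rfl

/-- The `p`-th power of the Wasserstein distance of order `p`. -/
def transportCost [EDist E] (p : ℝ) (μ ν : Measure E) : ℝ≥0∞ :=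
  ⨅ π ∈ couplings μ ν, ∫⁻ w, edist w.1 w.2 ^ p ∂π

theorem transportCost_le_of_refining [EDist E] {T : ℕ → SimpleFunc E ι} {D : ℕ → ℝ≥0∞} {p : ℝ}
    (hp : 0 ≤ p) (h0 : ∀ x y, T 0 x = T 0 y) (K : ℕ)
    (hT : ∀ k < K, ∀ x y, T (k + 1) x = T (k + 1) y → T k x = T k y)
    (hD : ∀ k ≤ K, ∀ x y, T k x = T k y → edist x y ≤ D k)
    (μ ν : Measure E) [IsProbabilityMeasure μ] [IsProbabilityMeasure ν] :
    transportCost p μ ν ≤ D K ^ p + ∑ k ∈ Finset.range K, D k ^ p *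
        ∑ c ∈ (T (k + 1)).range, (μ (T (k + 1) ⁻¹' {c}) - ν (T (k + 1) ⁻¹' {c})) := by
  obtain ⟨π, hπ, hle⟩ := exists_coupling_of_refining hp h0 K hT hD μ ν (by simp)
  rw [measure_univ, mul_one] at hle
  exact (iInf₂_le π hπ).trans hle

end Transport

/-! ### Nested partitions of a compact metric space -/

section Tree

variable {E : Type*} [MetricSpace E] [CompactSpace E] [Nonempty E] [MeasurableSpace E] [BorelSpace E]

/-- By compactness finitely many points of a dense sequence form a `δ`-net, and the nearest-point
map onto an initial segment of the sequence is measurable. -/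
theorem exists_simpleFunc_dist_le {δ : ℝ} (hδ : 0 < δ) :
    ∃ U : SimpleFunc E E, ∀ x, dist x (U x) ≤ δ := by
  have hopen : ∀ n : ℕ, IsOpen (Metric.ball (TopologicalSpace.denseSeq E n) δ) :=
    fun n => Metric.isOpen_ball
  obtain ⟨t, ht⟩ := (isCompact_univ (X := E)).elim_finite_subcover _ hopen fun x _ => by
    obtain ⟨n, hn⟩ := (TopologicalSpace.denseRange_denseSeq E).exists_dist_lt x hδ
    exact Set.mem_iUnion.2 ⟨n, hn⟩
  refine ⟨SimpleFunc.nearestPt (TopologicalSpace.denseSeq E) (t.sup id), fun x => ?_⟩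
  obtain ⟨n, hn, hx⟩ := Set.mem_iUnion₂.1 (ht (Set.mem_univ x))
  have h := SimpleFunc.edist_nearestPt_le (TopologicalSpace.denseSeq E) x
    (Finset.le_sup (f := id) hn)
  rw [edist_dist, edist_dist, ENNReal.ofReal_le_ofReal_iff dist_nonneg] at h
  rw [dist_comm]
  refine h.trans ?_
  rw [dist_comm]
  exact (Metric.mem_ball.1 hx).le

/-- `g k ∘ g (k + 1) ∘ ⋯ ∘ g (k + m - 1)`. -/
def iterateDown (g : ℕ → E → E) : ℕ → ℕ → E → E
  | 0, _ => id
  | m + 1, k => g k ∘ iterateDown g m (k + 1)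

/-- A nested sequence of finite measurable partitions, the fibres of `T 0, …, T K`, with the `k`-th
one of mesh of order `4 ^ (-k)`, such that the fibres over `F k` contain any set which is
covered by the closed balls of radius `4 ^ (-k)` around `F k`. -/
theorem exists_refining_simpleFunc (F : ℕ → Finset E) (K : ℕ) :
    ∃ T : ℕ → SimpleFunc E E,
      (∀ k < K, ∀ x y, T (k + 1) x = T (k + 1) y → T k x = T k y) ∧
      (∀ k ≤ K, ∀ x, dist x (T k x) ≤ 2 * (1 / 4) ^ k) ∧
      (∀ k ≤ K, ∀ x, (∃ c ∈ F k, dist x c ≤ (1 / 4) ^ k) → T k x ∈ F k) := by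
  classical
  -- The allowed step is `(3 / 2) * 4 ^ (-k)`. A level `k + 1` representative of `x` lies within `(1
  -- / 2) * 4 ^ (-k)` of `x`, so a centre within `4 ^ (-k)` of `x` is still within reach. The total
  -- displacement telescopes to `2 * 4 ^ (-k)`.
  have hg : ∀ k, ∀ x : E, ∃ y, dist x y ≤ 2 * (1 / 4) ^ k - 2 * (1 / 4) ^ (k + 1) ∧
      ((∃ c ∈ F k, dist x c ≤ 2 * (1 / 4) ^ k - 2 * (1 / 4) ^ (k + 1)) → y ∈ F k) := by
    intro k x
    by_cases h : ∃ c ∈ F k, dist x c ≤ 2 * (1 / 4) ^ k - 2 * (1 / 4) ^ (k + 1)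
    · obtain ⟨c, hc, hd⟩ := h
      exact ⟨c, hd, fun _ => hc⟩
    · refine ⟨x, ?_, fun h' => absurd h' h⟩
      rw [dist_self, pow_succ]
      have : (0 : ℝ) < (1 / 4) ^ k := by positivity
      linarith
  choose g hgd hgF using hg
  -- Discretising first with a simple function makes any composition with the arbitrarily chosen
  -- maps `g k` measurable.
  obtain ⟨U, hU⟩ := exists_simpleFunc_dist_le (E := E) (δ := 2 * (1 / 4) ^ (K + 1)) (by positivity)
  have hstep : ∀ k ≤ K, ∀ x, iterateDown g (K + 1 - k) k (U x)
      = g k (iterateDown g (K + 1 - (k + 1)) (k + 1) (U x)) := by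
    intro k hk x
    obtain ⟨m, hm⟩ : ∃ m, K + 1 - k = m + 1 := ⟨K - k, by omega⟩
    have hm' : K + 1 - (k + 1) = m := by omega
    rw [hm, hm']
    rfl
  have hdist : ∀ k ≤ K + 1, ∀ x, dist x (iterateDown g (K + 1 - k) k (U x)) ≤ 2 * (1 / 4) ^ k := by
    intro k hk
    induction hk using Nat.decreasingInduction with
    | self => intro x; simpa [iterateDown] using hU x
    | of_succ j hj ih =>
      intro x
      rw [hstep j (Nat.lt_succ_iff.1 hj) x]
      refine (dist_triangle _ (iterateDown g (K + 1 - (j + 1)) (j + 1) (U x)) _).trans ?_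
      linarith [ih x, hgd j (iterateDown g (K + 1 - (j + 1)) (j + 1) (U x))]
  refine ⟨fun k => U.map (iterateDown g (K + 1 - k) k), ?_, ?_, ?_⟩
  · intro k hk x y hxy
    simp only [SimpleFunc.map_apply] at hxy ⊢
    rw [hstep k hk.le, hstep k hk.le, hxy]
  · intro k hk x
    exact hdist k (hk.trans (Nat.le_succ K)) x
  · rintro k hk x ⟨c, hc, hxc⟩
    simp only [SimpleFunc.map_apply]
    rw [hstep k hk]
    refine hgF k _ ⟨c, hc, ?_⟩
    refine (dist_triangle_left _ _ x).trans ?_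
    have := hdist (k + 1) (Nat.succ_le_succ hk) x
    rw [pow_succ] at this ⊢
    linarith

/-- Wasserstein bound along nested partitions whose `k`-th one has mesh of order `4 ^ (-k)`. -/
theorem exists_transportCost_bound {p : ℝ} (hp : 0 ≤ p) :
    ∃ Δ : ℝ, 0 < Δ ∧ ∀ (F : ℕ → Finset E) (K : ℕ), ∃ T : ℕ → SimpleFunc E E,
      (∀ k, 1 ≤ k → k ≤ K → ∀ x, (∃ c ∈ F k, dist x c ≤ (1 / 4) ^ k) → T k x ∈ F k) ∧
      ∀ (μ ν : Measure E) [IsProbabilityMeasure μ] [IsProbabilityMeasure ν],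
        transportCost p μ ν ≤ ENNReal.ofReal (Δ * (1 / 4) ^ K) ^ p
          + ∑ k ∈ Finset.range K, ENNReal.ofReal (Δ * (1 / 4) ^ k) ^ p *
            ∑ c ∈ (T (k + 1)).range, (μ (T (k + 1) ⁻¹' {c}) - ν (T (k + 1) ⁻¹' {c})) := by
  -- Two points of a fibre are both within `2 * 4 ^ (-k)` of their common value, whence `4`. The
  -- diameter serves level `0`, where `T 0` is replaced by a constant so that the coarsest partition
  -- is trivial.
  refine ⟨max 4 (Metric.diam (Set.univ : Set E)), by positivity, fun F K => ?_⟩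
  obtain ⟨T, hT, hd, hF⟩ := exists_refining_simpleFunc F K
  let S : ℕ → SimpleFunc E E := fun k =>
    if k = 0 then SimpleFunc.const E (Classical.arbitrary E) else T k
  have hS : ∀ k, S (k + 1) = T (k + 1) := fun k => rfl
  refine ⟨S, ?_, ?_⟩
  · intro k hk1 hk
    obtain ⟨m, rfl⟩ := Nat.exists_eq_add_of_le' hk1
    rw [hS]
    exact hF _ hk
  · intro μ ν _ _
    refine transportCost_le_of_refining (T := S)
      (D := fun k => ENNReal.ofReal (max 4 (Metric.diam (Set.univ : Set E)) * (1 / 4) ^ k))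
      hp (fun _ _ => rfl) K ?_ ?_ μ ν
    · intro k hk x y hxy
      rcases k with _ | k
      · rfl
      · exact hT _ hk _ _ hxy
    · intro k hk x y hxy
      rw [edist_dist]
      refine ENNReal.ofReal_le_ofReal ?_
      rcases k with _ | k
      · simpa using Or.inr
          (Metric.dist_le_diam_of_mem (isCompact_univ.isBounded) (Set.mem_univ x) (Set.mem_univ y))
      · rw [hS] at hxy
        have h1 := hd _ hk x
        have h2 := hd _ hk y
        rw [← hxy] at h2
        calc dist x y ≤ 4 * (1 / 4) ^ (k + 1) := by
              linarith [dist_triangle_right x y (T (k + 1) x)]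
          _ ≤ _ := by gcongr; exact le_max_left _ _

/-- Wasserstein bound with a single partition of small mesh. -/
theorem exists_transportCost_le_add {p : ℝ} (hp : 0 ≤ p) {δ : ℝ} (hδ : 0 < δ) :
    ∃ (D : ℝ≥0∞) (U : SimpleFunc E E), D ≠ ⊤ ∧
      ∀ (μ ν : Measure E) [IsProbabilityMeasure μ] [IsProbabilityMeasure ν],
        transportCost p μ ν ≤ ENNReal.ofReal δ ^ p
          + D * ∑ c ∈ U.range, (μ (U ⁻¹' {c}) - ν (U ⁻¹' {c})) := by
  obtain ⟨U, hU⟩ := exists_simpleFunc_dist_le (E := E) (half_pos hδ)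
  refine ⟨ENNReal.ofReal (Metric.diam (Set.univ : Set E)) ^ p, U, by finiteness, ?_⟩
  intro μ ν _ _
  -- A hierarchy of two levels: the whole space, then the fibres of `U`.
  let S : ℕ → SimpleFunc E E := fun k =>
    if k = 0 then SimpleFunc.const E (Classical.arbitrary E) else U
  have := transportCost_le_of_refining (T := S) (D := fun k => if k = 0 then
      ENNReal.ofReal (Metric.diam (Set.univ : Set E)) else ENNReal.ofReal δ)
      hp (fun _ _ => rfl) 1 ?_ ?_ μ ν
  · simpa [S] using this
  · intro k hk x y _
    obtain rfl : k = 0 := by omega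
    rfl
  · intro k hk x y hxy
    rw [edist_dist]
    rcases k with _ | k
    · exact ENNReal.ofReal_le_ofReal (Metric.dist_le_diam_of_mem (isCompact_univ.isBounded)
        (Set.mem_univ x) (Set.mem_univ y))
    · refine ENNReal.ofReal_le_ofReal ?_
      change U x = U y at hxy
      have h2 := hU y
      rw [← hxy] at h2
      linarith [dist_triangle_right x y (U x), hU x]

end Tree

/-! ### Fluctuations of empirical measures on cells -/

section Empirical

variable {E : Type*} [MeasurableSpace E]

theorem empiricalMeasure_apply (z : ℕ → E) (n : ℕ) {Q : Set E} (hQ : MeasurableSet Q) :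
    empiricalMeasure z n Q = (n : ℝ≥0∞)⁻¹ * ∑ i ∈ Finset.range n, Q.indicator 1 (z i) := by
  simp [empiricalMeasure, Measure.finsetSum_apply, Measure.dirac_apply' _ hQ]

theorem isProbabilityMeasure_empiricalMeasure (z : ℕ → E) {n : ℕ} (hn : 1 ≤ n) :
    IsProbabilityMeasure (empiricalMeasure z n) := by
  constructor
  rw [empiricalMeasure_apply z n MeasurableSet.univ]
  simp [ENNReal.inv_mul_cancel (a := (n : ℝ≥0∞)) (by simp; omega) (by simp)]

theorem empiricalMeasure_map {F : Type*} [MeasurableSpace F] (z : ℕ → E) (n : ℕ) {f : E → F}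
    (hf : Measurable f) :
    (empiricalMeasure z n).map f = empiricalMeasure (fun i => f (z i)) n := by
  rw [empiricalMeasure, empiricalMeasure, Measure.map_smul, ← Measure.mapₗ_apply_of_measurable hf,
    map_sum]
  congr 1
  refine Finset.sum_congr rfl fun i _ => ?_
  rw [Measure.mapₗ_apply_of_measurable hf, Measure.map_dirac' hf]

theorem empiricalMeasure_real_apply (z : ℕ → E) (n : ℕ) {Q : Set E} (hQ : MeasurableSet Q) :
    (empiricalMeasure z n).real Q = (∑ i ∈ Finset.range n, Q.indicator 1 (z i)) / n := by
  rw [measureReal_def, empiricalMeasure_apply z n hQ, ENNReal.toReal_mul, ENNReal.toReal_sum]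
  · rw [div_eq_inv_mul]
    congr 1
    · simp
    · refine Finset.sum_congr rfl fun i _ => ?_
      by_cases h : z i ∈ Q <;> simp [h]
  · intro i _
    by_cases h : z i ∈ Q <;> simp [h]

variable {Θ : Type*} [MeasurableSpace Θ] {P : Measure Θ} {μ : Measure E} {Z : ℕ → Θ → E}

theorem IsIIDSample.comp {F : Type*} [MeasurableSpace F] (hZ : IsIIDSample P μ Z) {f : E → F}
    (hf : Measurable f) : IsIIDSample P (μ.map f) (fun i θ => f (Z i θ)) where
  measurable i := hf.comp (hZ.measurable i)
  indep := hZ.indep.comp (fun _ => f) fun _ => hf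
  law i := by
    rw [← hZ.law i, Measure.map_map hf (hZ.measurable i)]
    rfl

theorem IsIIDSample.measurable_empiricalMeasure_apply (hZ : IsIIDSample P μ Z) (n : ℕ) {Q : Set E}
    (hQ : MeasurableSet Q) : Measurable fun θ => empiricalMeasure (fun i => Z i θ) n Q := by
  simp_rw [empiricalMeasure_apply _ n hQ]
  refine Measurable.const_mul (Finset.measurable_sum _ fun i _ => ?_) _
  exact (measurable_one.indicator hQ).comp (hZ.measurable i)

theorem IsIIDSample.lintegral_empiricalMeasure_apply (hZ : IsIIDSample P μ Z) {n : ℕ} (hn : 1 ≤ n)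
    {Q : Set E} (hQ : MeasurableSet Q) :
    ∫⁻ θ, empiricalMeasure (fun i => Z i θ) n Q ∂P = μ Q := by
  have hm (i : ℕ) : Measurable fun θ => Q.indicator (1 : E → ℝ≥0∞) (Z i θ) :=
    (measurable_one.indicator hQ).comp (hZ.measurable i)
  simp_rw [empiricalMeasure_apply _ n hQ]
  rw [lintegral_const_mul _ (Finset.measurable_sum _ fun i _ => hm i),
    lintegral_finsetSum _ fun i _ => hm i]
  have : ∀ i, ∫⁻ θ, Q.indicator (1 : E → ℝ≥0∞) (Z i θ) ∂P = μ Q := fun i => by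
    rw [← lintegral_map (f := Q.indicator (1 : E → ℝ≥0∞)) (measurable_one.indicator hQ)
      (hZ.measurable i), hZ.law, lintegral_indicator_one hQ]
  simp only [this, Finset.sum_const, Finset.card_range, nsmul_eq_mul]
  rw [← mul_assoc, ENNReal.inv_mul_cancel (by simp; omega) (by simp), one_mul]

theorem IsIIDSample.integral_indicator (hZ : IsIIDSample P μ Z) {Q : Set E}
    (hQ : MeasurableSet Q) (i : ℕ) : ∫ θ, Q.indicator (1 : E → ℝ) (Z i θ) ∂P = μ.real Q := by
  rw [← integral_map (f := Q.indicator (1 : E → ℝ)) (hZ.measurable i).aemeasurable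
    (measurable_one.indicator hQ).aestronglyMeasurable, hZ.law, integral_indicator_one hQ]

variable [IsProbabilityMeasure P]

theorem IsIIDSample.isProbabilityMeasure (hZ : IsIIDSample P μ Z) : IsProbabilityMeasure μ := by
  rw [← hZ.law 0]
  exact Measure.isProbabilityMeasure_map (hZ.measurable 0).aemeasurable

theorem IsIIDSample.memLp_indicator (hZ : IsIIDSample P μ Z) {Q : Set E}
    (hQ : MeasurableSet Q) (i : ℕ) (q : ℝ≥0∞) :
    MemLp (fun θ => Q.indicator (1 : E → ℝ) (Z i θ)) q P := by
  refine MemLp.of_bound ((measurable_one.indicator hQ).comp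
    (hZ.measurable i)).aestronglyMeasurable 1 (ae_of_all _ fun θ => ?_)
  by_cases h : Z i θ ∈ Q <;> simp [h]

/-- By independence the variance of the count in `Q` is the sum of the variances of the indicators,
each at most `μ(Q)`. -/
theorem IsIIDSample.integral_sq_empiricalMeasure_sub_le (hZ : IsIIDSample P μ Z) {n : ℕ}
    (hn : 1 ≤ n) {Q : Set E} (hQ : MeasurableSet Q) :
    Integrable (fun θ => ((empiricalMeasure (fun i => Z i θ) n).real Q - μ.real Q) ^ 2) P ∧
    ∫ θ, ((empiricalMeasure (fun i => Z i θ) n).real Q - μ.real Q) ^ 2 ∂P ≤ μ.real Q / n := by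
  have hn' : (0 : ℝ) < n := by exact_mod_cast hn
  set Y : ℕ → Θ → ℝ := fun i θ => Q.indicator (1 : E → ℝ) (Z i θ) with hY
  have hL (i : ℕ) : MemLp (Y i) 2 P := hZ.memLp_indicator hQ i 2
  have hsum : MemLp (∑ i ∈ Finset.range n, Y i) 2 P := memLp_finsetSum' _ fun i _ => hL i
  have hmean : ∫ θ, (∑ i ∈ Finset.range n, Y i) θ ∂P = n * μ.real Q := by
    simp_rw [Finset.sum_apply]
    rw [integral_finsetSum _ fun i _ => (hL i).integrable one_le_two]
    simp [hY, hZ.integral_indicator hQ]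
  have hvar (i : ℕ) : variance (Y i) P ≤ μ.real Q := by
    refine (variance_le_expectation_sq (hL i).1).trans ?_
    rw [← hZ.integral_indicator hQ i]
    refine le_of_eq (integral_congr_ae (ae_of_all _ fun θ => ?_))
    by_cases h : Z i θ ∈ Q <;> simp [hY, h]
  have hvs : variance (∑ i ∈ Finset.range n, Y i) P ≤ n * μ.real Q := by
    rw [IndepFun.variance_sum (fun i _ => hL i)]
    · simpa using Finset.sum_le_sum (s := Finset.range n) fun i _ => hvar i
    · intro i _ j _ hij
      exact (hZ.indep.indepFun hij).comp (φ := Q.indicator (1 : E → ℝ))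
        (ψ := Q.indicator (1 : E → ℝ)) (measurable_one.indicator hQ) (measurable_one.indicator hQ)
  have heq (θ : Θ) : ((empiricalMeasure (fun i => Z i θ) n).real Q - μ.real Q) ^ 2
      = (((∑ i ∈ Finset.range n, Y i) θ) - n * μ.real Q) ^ 2 / n ^ 2 := by
    rw [empiricalMeasure_real_apply _ n hQ, Finset.sum_apply]
    change _ = (∑ i ∈ Finset.range n, Q.indicator (1 : E → ℝ) (Z i θ) - _) ^ 2 / _
    field_simp
  simp_rw [heq]
  refine ⟨((hsum.sub (memLp_const _)).integrable_sq).div_const _, ?_⟩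
  rw [integral_div, ← hmean, ← variance_eq_integral hsum.aemeasurable, div_le_div_iff₀
    (by positivity) hn']
  calc _ ≤ (n * μ.real Q) * n := by gcongr
    _ = _ := by ring

/-- From `t ≤ (t ^ 2 / a + a) / 2` and the variance bound. Leaving `a` free allows one value for all
cells, which replaces Cauchy–Schwarz over the cells. -/
theorem IsIIDSample.lintegral_empiricalMeasure_sub_le (hZ : IsIIDSample P μ Z) {n : ℕ}
    (hn : 1 ≤ n) {Q : Set E} (hQ : MeasurableSet Q) {a : ℝ} (ha : 0 < a) :
    ∫⁻ θ, (empiricalMeasure (fun i => Z i θ) n Q - μ Q) ∂P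
      ≤ ENNReal.ofReal ((μ.real Q / (n * a) + a) / 2) := by
  have := hZ.isProbabilityMeasure
  have hn' : (0 : ℝ) < n := by exact_mod_cast hn
  obtain ⟨hint, hle⟩ := hZ.integral_sq_empiricalMeasure_sub_le hn hQ
  set t : Θ → ℝ := fun θ => (empiricalMeasure (fun i => Z i θ) n).real Q - μ.real Q
  have hint2 : Integrable (fun θ => (t θ ^ 2 / a + a) / 2) P :=
    ((hint.div_const a).add (integrable_const a)).div_const 2
  calc ∫⁻ θ, (empiricalMeasure (fun i => Z i θ) n Q - μ Q) ∂P
      ≤ ∫⁻ θ, ENNReal.ofReal ((t θ ^ 2 / a + a) / 2) ∂P := by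
        refine lintegral_mono fun θ => ?_
        have := isProbabilityMeasure_empiricalMeasure (fun i => Z i θ) hn
        rw [← ofReal_measureReal (μ := μ), ← ofReal_measureReal (μ := empiricalMeasure _ n),
          ← ENNReal.ofReal_sub _ measureReal_nonneg]
        refine ENNReal.ofReal_le_ofReal ?_
        change t θ ≤ _
        have : 0 ≤ (t θ - a) ^ 2 / a := by positivity
        have h2 : (t θ - a) ^ 2 / a = t θ ^ 2 / a - 2 * t θ + a := by field_simp; ring
        linarith
    _ = ENNReal.ofReal (∫ θ, (t θ ^ 2 / a + a) / 2 ∂P) :=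
        (ofReal_integral_eq_lintegral_ofReal hint2 (ae_of_all _ fun θ => by
          change (0 : ℝ) ≤ _; positivity)).symm
    _ ≤ _ := by
        refine ENNReal.ofReal_le_ofReal ?_
        rw [integral_div, integral_add (hint.div_const a) (integrable_const a), integral_div]
        simp only [integral_const, probReal_univ, smul_eq_mul, one_mul]
        rw [← div_div]
        gcongr

/-- The expected discrepancy between the empirical measure and the law on a finite partition, in
terms of the number of the cells in `G` and of the mass of the others. -/
theorem IsIIDSample.lintegral_sum_empiricalMeasure_sub_le {ι : Type*} (hZ : IsIIDSample P μ Z)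
    {n : ℕ} (hn : 1 ≤ n) (U : SimpleFunc E ι) (G : Finset ι) {M : ℝ} (hM : 0 < M)
    (hGM : (G.card : ℝ) ≤ M) :
    ∫⁻ θ, ∑ c ∈ U.range, (empiricalMeasure (fun i => Z i θ) n (U ⁻¹' {c}) - μ (U ⁻¹' {c})) ∂P
      ≤ ENNReal.ofReal √(M / n) + μ {x | U x ∉ G} := by
  classical
  have := hZ.isProbabilityMeasure
  have hn' : (0 : ℝ) < n := by exact_mod_cast hn
  have hm (c : ι) : Measurable fun θ =>
      empiricalMeasure (fun i => Z i θ) n (U ⁻¹' {c}) - μ (U ⁻¹' {c}) :=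
    (hZ.measurable_empiricalMeasure_apply n (U.measurableSet_fiber c)).sub measurable_const
  rw [lintegral_finsetSum _ fun c _ => hm c, ← Finset.sum_filter_add_sum_filter_not _ (· ∈ G)]
  refine add_le_add ?_ ?_
  -- This `a` balances the two terms: `1 / (n * a)` and `M * a` both equal `√(M / n)`.
  · set a : ℝ := 1 / √(n * M) with ha
    have hpos : 0 < √(n * M) := by positivity
    have ha0 : 0 < a := by positivity
    calc _ ≤ ∑ c ∈ U.range with c ∈ G,
          ENNReal.ofReal ((μ.real (U ⁻¹' {c}) / (n * a) + a) / 2) :=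
          Finset.sum_le_sum fun c _ =>
            hZ.lintegral_empiricalMeasure_sub_le hn (U.measurableSet_fiber c) ha0
      _ = ENNReal.ofReal (∑ c ∈ U.range with c ∈ G, (μ.real (U ⁻¹' {c}) / (n * a) + a) / 2) :=
          (ENNReal.ofReal_sum_of_nonneg fun c _ => by positivity).symm
      _ ≤ _ := by
          refine ENNReal.ofReal_le_ofReal ?_
          rw [← Finset.sum_div, Finset.sum_add_distrib, ← Finset.sum_div, Finset.sum_const,
            nsmul_eq_mul]
          have h1 : ∑ c ∈ U.range with c ∈ G, μ.real (U ⁻¹' {c}) ≤ 1 := by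
            calc _ ≤ ∑ c ∈ U.range, μ.real (U ⁻¹' {c}) :=
                  Finset.sum_le_sum_of_subset_of_nonneg (Finset.filter_subset _ _)
                    fun _ _ _ => measureReal_nonneg
              _ = 1 := by
                  have h := measure_eq_sum_fiber U μ
                  have h' := congrArg ENNReal.toReal h
                  rw [ENNReal.toReal_sum fun c _ => measure_ne_top _ _] at h'
                  simpa [measureReal_def] using h'.symm
          have h2 : (((U.range.filter (· ∈ G)).card : ℕ) : ℝ) ≤ M := by
            refine le_trans ?_ hGM
            exact_mod_cast Finset.card_le_card fun c hc => (Finset.mem_filter.1 hc).2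
          have hs : √(n * M) = n * √(M / n) := by
            rw [show (n : ℝ) * M = n ^ 2 * (M / n) by field_simp, Real.sqrt_mul (by positivity),
              Real.sqrt_sq hn'.le]
          have h3 : 1 / (n * a) = √(M / n) := by
            rw [ha, hs]
            have : 0 < √(M / n) := by positivity
            field_simp
          have h4 : M * a = √(M / n) := by
            have h5 : √(n * M) * √(M / n) = M := by
              rw [hs, mul_assoc, Real.mul_self_sqrt (by positivity)]; field_simp
            rw [ha, mul_one_div, div_eq_iff hpos.ne', mul_comm, h5]
          have h6 : (∑ c ∈ U.range with c ∈ G, μ.real (U ⁻¹' {c})) / (n * a) ≤ √(M / n) := by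
            rw [← h3]; gcongr
          have h7 : ((U.range.filter (· ∈ G)).card : ℝ) * a ≤ √(M / n) := by
            rw [← h4]; gcongr
          linarith
  -- Outside `G` the positive part is bounded by the empirical mass, whose expectation is the
  -- `μ`-mass.
  · calc _ ≤ ∑ c ∈ U.range with c ∉ G, μ (U ⁻¹' {c}) := by
          refine Finset.sum_le_sum fun c _ => ?_
          rw [← hZ.lintegral_empiricalMeasure_apply hn (U.measurableSet_fiber c)]
          exact lintegral_mono fun θ => tsub_le_self
      _ = μ (⋃ c ∈ U.range.filter (· ∉ G), U ⁻¹' {c}) := by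
          refine (measure_biUnion_finset ?_ fun c _ => U.measurableSet_fiber c).symm
          intro c _ c' _ hcc
          exact Set.disjoint_left.2 fun x hx hx' => hcc (by
            rw [Set.mem_preimage, Set.mem_singleton_iff] at hx hx'; rw [← hx, ← hx'])
      _ ≤ _ := by
          refine measure_mono ?_
          intro x hx
          simp only [Set.mem_iUnion, Finset.mem_filter] at hx
          obtain ⟨c, ⟨-, hc⟩, hxc⟩ := hx
          rw [Set.mem_preimage, Set.mem_singleton_iff] at hxc
          change U x ∉ G
          rwa [hxc]

theorem IsIIDSample.ae_tendsto_empiricalMeasure_sub (hZ : IsIIDSample P μ Z) {Q : Set E}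
    (hQ : MeasurableSet Q) :
    ∀ᵐ θ ∂P, Tendsto (fun n => empiricalMeasure (fun i => Z i θ) n Q - μ Q) atTop (𝓝 0) := by
  have := hZ.isProbabilityMeasure
  have hm : Measurable (Q.indicator (1 : E → ℝ)) := measurable_one.indicator hQ
  have h := strong_law_ae_real (μ := P) (fun i θ => Q.indicator (1 : E → ℝ) (Z i θ))
    ((hZ.memLp_indicator hQ 0 1).integrable le_rfl)
    (fun i j hij => (hZ.indep.indepFun hij).comp hm hm)
    (fun i => (IdentDistrib.comp ⟨(hZ.measurable i).aemeasurable, (hZ.measurable 0).aemeasurable,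
      by rw [hZ.law, hZ.law]⟩ hm))
  filter_upwards [h] with θ hθ
  rw [hZ.integral_indicator hQ 0] at hθ
  have h2 : Tendsto (fun n => ENNReal.ofReal
      ((empiricalMeasure (fun i => Z i θ) n).real Q - μ.real Q)) atTop (𝓝 0) := by
    simp_rw [empiricalMeasure_real_apply _ _ hQ]
    have := (ENNReal.continuous_ofReal.tendsto _).comp (hθ.sub_const (μ.real Q))
    simpa [Function.comp_def] using this
  refine h2.congr' ?_
  filter_upwards [eventually_ge_atTop 1] with n hn
  have := isProbabilityMeasure_empiricalMeasure (fun i => Z i θ) hn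
  rw [ENNReal.ofReal_sub _ measureReal_nonneg, ofReal_measureReal, ofReal_measureReal]

end Empirical

/-- Empirical measures converge in the Wasserstein sense on a compact metric space. -/
theorem IsIIDSample.ae_tendsto_transportCost {E : Type*} [MetricSpace E] [CompactSpace E]
    [MeasurableSpace E] [BorelSpace E] {Θ : Type*} [MeasurableSpace Θ] {P : Measure Θ}
    [IsProbabilityMeasure P] {μ : Measure E} {Z : ℕ → Θ → E} (hZ : IsIIDSample P μ Z) {p : ℝ}
    (hp : 0 < p) :
    ∀ᵐ θ ∂P, Tendsto (fun n => transportCost p (empiricalMeasure (fun i => Z i θ) n) μ) atTop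
      (𝓝 0) := by
  have := hZ.isProbabilityMeasure
  have : Nonempty E := nonempty_of_isProbabilityMeasure μ
  choose D U hD hU using fun m : ℕ =>
    exists_transportCost_le_add (E := E) hp.le (δ := 1 / ((m : ℝ) + 1)) (by positivity)
  -- Countably many meshes with finitely many cells each: one null set serves them all.
  have hae : ∀ᵐ θ ∂P, ∀ m : ℕ, ∀ c ∈ (U m).range, Tendsto
      (fun n => empiricalMeasure (fun i => Z i θ) n (U m ⁻¹' {c}) - μ (U m ⁻¹' {c}))
      atTop (𝓝 0) := by
    rw [ae_all_iff]
    intro m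
    refine (ae_ball_iff (U m).range.countable_toSet).2 ?_
    exact fun c _ => hZ.ae_tendsto_empiricalMeasure_sub ((U m).measurableSet_fiber c)
  filter_upwards [hae] with θ hθ
  rw [ENNReal.tendsto_nhds_zero]
  intro ε hε
  have hlim : Tendsto (fun m : ℕ => ENNReal.ofReal (1 / ((m : ℝ) + 1)) ^ p) atTop (𝓝 0) := by
    have := (ENNReal.continuous_ofReal.tendsto _).comp
      (tendsto_one_div_add_atTop_nhds_zero_nat (𝕜 := ℝ))
    have := ((ENNReal.continuous_rpow_const (y := p)).tendsto _).comp this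
    simpa [Function.comp_def, ENNReal.zero_rpow_of_pos hp] using this
  obtain ⟨m, hm⟩ := (hlim.eventually (gt_mem_nhds (ENNReal.half_pos hε.ne'))).exists
  have hsum : Tendsto (fun n => D m * ∑ c ∈ (U m).range,
      (empiricalMeasure (fun i => Z i θ) n (U m ⁻¹' {c}) - μ (U m ⁻¹' {c}))) atTop (𝓝 0) := by
    have := ENNReal.Tendsto.const_mul (tendsto_finsetSum _ (hθ m)) (Or.inr (hD m))
    simpa using this
  filter_upwards [hsum.eventually (gt_mem_nhds (ENNReal.half_pos hε.ne')), eventually_ge_atTop 1]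
    with n hn hn1
  have := isProbabilityMeasure_empiricalMeasure (fun i => Z i θ) hn1
  refine (hU m _ μ).trans ?_
  rw [← ENNReal.add_halves ε]
  exact add_le_add hm.le hn.le

/-! ### The Wasserstein rate from covering numbers -/

section Rate

/-- The sum over the scales `4 ^ (-k)` down to `4 ^ (-K) ≈ n ^ (-1 / s)`. -/
theorem sum_scales_le {p s K₀ Δ : ℝ} (hp : 1 ≤ p) (hs : 2 * p < s) (hK₀ : 0 ≤ K₀) (hΔ : 0 < Δ)
    {n : ℝ} (hn : 1 ≤ n) {K : ℕ} (hK1 : (4 : ℝ) ^ K ≤ n ^ (1 / s))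
    (hK2 : n ^ (1 / s) < (4 : ℝ) ^ (K + 1)) :
    (Δ * (1 / 4) ^ K) ^ p + ∑ k ∈ Finset.range K, (Δ * (1 / 4) ^ k) ^ p *
        (K₀ * (((4 : ℝ) ^ (k + 1)) ^ (s / 2) * n ^ (-(1 / 2) : ℝ) + n ^ (-p / s)) + n ^ (-p / s))
      ≤ Δ ^ p * (4 ^ p + K₀ * (4 ^ (s / 2) / (4 ^ (s / 2 - p) - 1) + 2) + 2) * n ^ (-p / s) := by
  have hn0 : 0 < n := by linarith
  have hs0 : 0 < s := by linarith
  set r : ℝ := n ^ (-p / s) with hr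
  have hr0 : 0 < r := by positivity
  set x : ℝ := n ^ (1 / s) with hx
  have hx0 : 0 < x := by positivity
  have hxr : x ^ (-p) = r := by
    rw [hx, hr, ← Real.rpow_mul hn0.le]; congr 1; ring
  set q : ℝ := 4 ^ (s / 2 - p) with hq
  have hq1 : 1 < q := Real.one_lt_rpow (by norm_num) (by linarith)
  have h1 : ((1 / 4 : ℝ) ^ K) ^ p ≤ 4 ^ p * r := by
    have : (1 / 4 : ℝ) ^ K ≤ 4 * x⁻¹ := by
      rw [one_div, inv_pow, ← div_eq_mul_inv, inv_eq_one_div,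
        div_le_div_iff₀ (by positivity) hx0]
      rw [pow_succ] at hK2
      linarith
    calc ((1 / 4 : ℝ) ^ K) ^ p ≤ (4 * x⁻¹) ^ p := by gcongr
      _ = 4 ^ p * r := by
        rw [Real.mul_rpow (by norm_num) (by positivity), Real.inv_rpow hx0.le,
          ← Real.rpow_neg hx0.le, hxr]
  have h2 : ∑ k ∈ Finset.range K, ((1 / 4 : ℝ) ^ k) ^ p ≤ 2 := by
    refine le_trans (Finset.sum_le_sum fun k _ => ?_) (sum_geometric_two_le K)
    calc ((1 / 4 : ℝ) ^ k) ^ p ≤ ((1 / 4 : ℝ) ^ k) ^ (1 : ℝ) :=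
          Real.rpow_le_rpow_of_exponent_ge (by positivity)
            (pow_le_one₀ (by norm_num) (by norm_num)) hp
      _ ≤ (1 / 2) ^ k := by
          rw [Real.rpow_one]
          exact pow_le_pow_left₀ (by norm_num) (by norm_num) k
  have h3 : ∑ k ∈ Finset.range K, ((1 / 4 : ℝ) ^ k) ^ p *
      (((4 : ℝ) ^ (k + 1)) ^ (s / 2) * n ^ (-(1 / 2) : ℝ)) ≤ 4 ^ (s / 2) / (q - 1) * r := by
    have hterm (k : ℕ) : ((1 / 4 : ℝ) ^ k) ^ p * (((4 : ℝ) ^ (k + 1)) ^ (s / 2) *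
        n ^ (-(1 / 2) : ℝ)) = 4 ^ (s / 2) * n ^ (-(1 / 2) : ℝ) * q ^ k := by
      rw [pow_succ, Real.mul_rpow (by positivity) (by norm_num), one_div, inv_pow,
        Real.inv_rpow (by positivity), hq, ← Real.rpow_natCast (_ ^ _) k, ← Real.rpow_mul (by norm_num),
        mul_comm (s / 2 - p), Real.rpow_mul (by norm_num), Real.rpow_natCast,
        Real.rpow_sub (by positivity)]
      ring
    -- The ratio `q` exceeds `1` because `s > 2 p`, so the last scale controls the geometric sum;
    -- there `4 ^ K ≤ n ^ (1 / s)` yields the exponent `-p / s`.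
    have hqK : q ^ K * n ^ (-(1 / 2) : ℝ) ≤ r := by
      calc q ^ K * n ^ (-(1 / 2) : ℝ) = ((4 : ℝ) ^ K) ^ (s / 2 - p) * n ^ (-(1 / 2) : ℝ) := by
            rw [hq, ← Real.rpow_natCast (_ ^ _) K, ← Real.rpow_mul (by norm_num),
              mul_comm (s / 2 - p), Real.rpow_mul (by norm_num), Real.rpow_natCast]
        _ ≤ x ^ (s / 2 - p) * n ^ (-(1 / 2) : ℝ) := by
            gcongr
            linarith
        _ = r := by
            rw [hx, hr, ← Real.rpow_mul hn0.le, ← Real.rpow_add hn0]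
            congr 1
            field_simp
            ring
    simp_rw [hterm]
    rw [← Finset.mul_sum, geom_sum_eq hq1.ne']
    have hq0 : 0 < q - 1 := by linarith
    calc 4 ^ (s / 2) * n ^ (-(1 / 2) : ℝ) * ((q ^ K - 1) / (q - 1))
        ≤ 4 ^ (s / 2) * n ^ (-(1 / 2) : ℝ) * (q ^ K / (q - 1)) := by
          gcongr
          linarith
      _ = 4 ^ (s / 2) / (q - 1) * (q ^ K * n ^ (-(1 / 2) : ℝ)) := by ring
      _ ≤ _ := by gcongr
  have hsplit : (Δ * (1 / 4) ^ K) ^ p + ∑ k ∈ Finset.range K, (Δ * (1 / 4) ^ k) ^ p *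
        (K₀ * (((4 : ℝ) ^ (k + 1)) ^ (s / 2) * n ^ (-(1 / 2) : ℝ) + r) + r)
      = Δ ^ p * (((1 / 4 : ℝ) ^ K) ^ p + K₀ * (∑ k ∈ Finset.range K, ((1 / 4 : ℝ) ^ k) ^ p *
        (((4 : ℝ) ^ (k + 1)) ^ (s / 2) * n ^ (-(1 / 2) : ℝ)))
        + (K₀ + 1) * r * ∑ k ∈ Finset.range K, ((1 / 4 : ℝ) ^ k) ^ p) := by
    rw [mul_add, mul_add, Real.mul_rpow hΔ.le (by positivity), add_assoc]
    congr 1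
    simp_rw [Finset.mul_sum]
    rw [← Finset.sum_add_distrib]
    refine Finset.sum_congr rfl fun k _ => ?_
    rw [Real.mul_rpow hΔ.le (by positivity)]
    ring
  rw [hsplit]
  calc _ ≤ Δ ^ p * (4 ^ p * r + K₀ * (4 ^ (s / 2) / (q - 1) * r) + (K₀ + 1) * r * 2) := by
        gcongr
    _ = _ := by ring

variable {E : Type*} [MetricSpace E] [CompactSpace E] [MeasurableSpace E] [BorelSpace E]

theorem exists_lintegral_transportCost_le_of_cover {μ : Measure E} [IsProbabilityMeasure μ]
    {p s K₀ : ℝ} (hp : 1 ≤ p) (hs : 2 * p < s) (hK₀ : 1 ≤ K₀)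
    (H : ∀ ε : ℝ, 0 < ε → ε ≤ 1 → ∃ (F : Finset E) (S : Set E), (F.card : ℝ) ≤ K₀ * ε ^ (-s) ∧
      μ Sᶜ ≤ ENNReal.ofReal (ε ^ (s * p / (s - 2 * p))) ∧ ∀ x ∈ S, ∃ c ∈ F, dist x c ≤ ε) :
    ∃ C : ℝ, ∀ (Θ : Type*) [MeasurableSpace Θ] (P : Measure Θ) [IsProbabilityMeasure P]
      (Z : ℕ → Θ → E), IsIIDSample P μ Z → ∀ n : ℕ, 1 ≤ n →
        ∫⁻ θ, transportCost p (empiricalMeasure (fun i => Z i θ) n) μ ∂P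
          ≤ ENNReal.ofReal (C * (n : ℝ) ^ (-p / s)) := by
  have : Nonempty E := nonempty_of_isProbabilityMeasure μ
  have hp0 : 0 < p := by linarith
  have hs0 : 0 < s := by linarith
  have hsp : 0 < s - 2 * p := by linarith
  obtain ⟨Δ, hΔ, hbound⟩ := exists_transportCost_bound (E := E) hp0.le
  refine ⟨Δ ^ p * (4 ^ p + K₀ * (4 ^ (s / 2) / (4 ^ (s / 2 - p) - 1) + 2) + 2), ?_⟩
  intro Θ _ P _ Z hZ n hn
  have hn1 : (1 : ℝ) ≤ n := by exact_mod_cast hn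
  have hn0 : (0 : ℝ) < n := by linarith
  obtain ⟨K, hK1, hK2⟩ := exists_nat_pow_near
    (Real.one_le_rpow hn1 (by positivity : 0 ≤ 1 / s)) (by norm_num : (1 : ℝ) < 4)
  -- The scale at which the permitted exceptional mass `η ^ (s p / (s - 2 p))` equals `r = n ^ (-p /
  -- s)`. At this scale `√(η ^ (-s) / n)` is also `r`.
  set η : ℝ := (n : ℝ) ^ (-((s - 2 * p) / s ^ 2)) with hη
  have hη0 : 0 < η := by positivity
  have hε0 (k : ℕ) : 0 < min ((1 / 4 : ℝ) ^ k) η := by positivity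
  -- Covering at a scale at most `η`, even at coarse levels, keeps the uncovered mass below `r`; the
  -- extra centres cost only another `r` per level.
  choose F S hFcard hS hFS using fun k : ℕ => H (min ((1 / 4 : ℝ) ^ k) η) (hε0 k)
    ((min_le_left _ _).trans (pow_le_one₀ (by norm_num) (by norm_num)))
  obtain ⟨T, hTF, hT⟩ := hbound F K
  set r : ℝ := (n : ℝ) ^ (-p / s) with hr
  have hr0 : 0 < r := by positivity
  set u : ℕ → ℝ := fun k => ((4 : ℝ) ^ k) ^ (s / 2) * (n : ℝ) ^ (-(1 / 2) : ℝ) with hu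
  have hu0 (k : ℕ) : 0 < u k := by positivity
  have hu2 (k : ℕ) : u k ^ 2 = ((4 : ℝ) ^ k) ^ s / n := by
    rw [hu]
    simp only
    rw [mul_pow, ← Real.rpow_mul_natCast (by positivity), ← Real.rpow_mul_natCast hn0.le,
      show -(1 / 2) * ((2 : ℕ) : ℝ) = -1 by norm_num, Real.rpow_neg_one, ← div_eq_mul_inv]
    norm_num
  have hr2 : r ^ 2 = η ^ (-s) / n := by
    rw [hr, hη, ← Real.rpow_mul_natCast hn0.le, ← Real.rpow_mul hn0.le, eq_div_iff hn0.ne',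
      ← Real.rpow_add_one hn0.ne']
    congr 1
    field_simp
    push_cast
    ring
  have hηr : η ^ (s * p / (s - 2 * p)) = r := by
    rw [hr, hη, ← Real.rpow_mul hn0.le]
    congr 1
    field_simp
  have hcard (k : ℕ) : ((F k).card : ℝ) ≤ (K₀ * (u k + r)) ^ 2 * n := by
    have h1 : min ((1 / 4 : ℝ) ^ k) η ^ (-s) ≤ ((4 : ℝ) ^ k) ^ s + η ^ (-s) := by
      rcases min_choice ((1 / 4 : ℝ) ^ k) η with h | h
      · rw [h, one_div, inv_pow, Real.inv_rpow (by positivity), ← Real.rpow_neg (by positivity),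
          neg_neg]
        exact le_add_of_nonneg_right (by positivity)
      · rw [h]
        exact le_add_of_nonneg_left (by positivity)
    have h2 : ((4 : ℝ) ^ k) ^ s + η ^ (-s) = (u k ^ 2 + r ^ 2) * n := by
      rw [hu2, hr2]; field_simp
    calc ((F k).card : ℝ) ≤ K₀ * ((u k ^ 2 + r ^ 2) * n) := by
          rw [← h2]; exact (hFcard k).trans (by gcongr)
      _ ≤ (K₀ * K₀) * ((u k + r) ^ 2 * n) := by
          have := hu0 k
          gcongr
          · nlinarith
          · nlinarith
      _ = _ := by ring
  have hlevel : ∀ k, 1 ≤ k → k ≤ K → ∫⁻ θ, ∑ c ∈ (T k).range,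
      (empiricalMeasure (fun i => Z i θ) n (T k ⁻¹' {c}) - μ (T k ⁻¹' {c})) ∂P
        ≤ ENNReal.ofReal (K₀ * (u k + r) + r) := by
    intro k hk1 hk
    have hpos : 0 < K₀ * (u k + r) := by have := hu0 k; positivity
    refine (hZ.lintegral_sum_empiricalMeasure_sub_le hn (T k) (F k)
      (M := (K₀ * (u k + r)) ^ 2 * n) (by positivity) (hcard k)).trans ?_
    rw [mul_div_cancel_right₀ _ hn0.ne', Real.sqrt_sq hpos.le, ENNReal.ofReal_add hpos.le hr0.le]
    gcongr
    rw [← hηr]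
    refine (measure_mono ?_).trans ((hS k).trans (ENNReal.ofReal_le_ofReal ?_))
    · intro x hx hxS
      obtain ⟨c, hc, hxc⟩ := hFS k x hxS
      exact hx (hTF k hk1 hk x ⟨c, hc, hxc.trans (min_le_left _ _)⟩)
    · gcongr
      exact min_le_right _ _
  have hm (k : ℕ) : Measurable fun θ => ∑ c ∈ (T k).range,
      (empiricalMeasure (fun i => Z i θ) n (T k ⁻¹' {c}) - μ (T k ⁻¹' {c})) :=
    Finset.measurable_sum _ fun c _ =>
      (hZ.measurable_empiricalMeasure_apply n ((T k).measurableSet_fiber c)).sub measurable_const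
  have hD (k : ℕ) : ENNReal.ofReal (Δ * (1 / 4) ^ k) ^ p
      = ENNReal.ofReal ((Δ * (1 / 4) ^ k) ^ p) :=
    ENNReal.ofReal_rpow_of_nonneg (by positivity) hp0.le
  calc ∫⁻ θ, transportCost p (empiricalMeasure (fun i => Z i θ) n) μ ∂P
      ≤ ∫⁻ θ, (ENNReal.ofReal (Δ * (1 / 4) ^ K) ^ p
          + ∑ k ∈ Finset.range K, ENNReal.ofReal (Δ * (1 / 4) ^ k) ^ p *
            ∑ c ∈ (T (k + 1)).range, (empiricalMeasure (fun i => Z i θ) n (T (k + 1) ⁻¹' {c})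
              - μ (T (k + 1) ⁻¹' {c}))) ∂P := by
        refine lintegral_mono fun θ => ?_
        have := isProbabilityMeasure_empiricalMeasure (fun i => Z i θ) hn
        exact hT _ μ
    _ = ENNReal.ofReal (Δ * (1 / 4) ^ K) ^ p
          + ∑ k ∈ Finset.range K, ENNReal.ofReal (Δ * (1 / 4) ^ k) ^ p *
            ∫⁻ θ, ∑ c ∈ (T (k + 1)).range, (empiricalMeasure (fun i => Z i θ) n
              (T (k + 1) ⁻¹' {c}) - μ (T (k + 1) ⁻¹' {c})) ∂P := by
        rw [lintegral_add_left measurable_const, lintegral_const, measure_univ, mul_one,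
          lintegral_finsetSum _ fun k _ => (hm (k + 1)).const_mul _]
        simp_rw [lintegral_const_mul _ (hm _)]
    _ ≤ ENNReal.ofReal ((Δ * (1 / 4) ^ K) ^ p) + ∑ k ∈ Finset.range K,
          ENNReal.ofReal ((Δ * (1 / 4) ^ k) ^ p) * ENNReal.ofReal (K₀ * (u (k + 1) + r) + r) := by
        simp_rw [hD]
        refine add_le_add le_rfl (Finset.sum_le_sum fun k hk => ?_)
        gcongr
        exact hlevel (k + 1) (by omega) (Finset.mem_range.1 hk)
    _ = ENNReal.ofReal ((Δ * (1 / 4) ^ K) ^ p + ∑ k ∈ Finset.range K,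
          (Δ * (1 / 4) ^ k) ^ p * (K₀ * (u (k + 1) + r) + r)) := by
        have hterm (k : ℕ) : 0 ≤ (Δ * (1 / 4) ^ k) ^ p * (K₀ * (u (k + 1) + r) + r) := by
          have := hu0 (k + 1)
          positivity
        rw [ENNReal.ofReal_add (by positivity) (Finset.sum_nonneg fun k _ => hterm k),
          ENNReal.ofReal_sum_of_nonneg fun k _ => hterm k]
        congr 1
        refine Finset.sum_congr rfl fun k _ => ?_
        rw [ENNReal.ofReal_mul (by positivity)]
    _ ≤ _ := ENNReal.ofReal_le_ofReal (sum_scales_le hp hs (by linarith) hΔ hn1 hK1 hK2)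

/-- Undoing the logarithms bounds the covering number by `ε ^ (-s)`. It is then finite, and an
infimum of extended naturals is attained, which gives an actual set and cover. -/
theorem exists_cover_of_measureCoveringDim_lt {E : Type*} [MetricSpace E] [MeasurableSpace E]
    {μ : Measure E} [IsProbabilityMeasure μ] {s ε τ : ℝ} (hε0 : 0 < ε) (hε1 : ε < 1)
    (h : measureCoveringDim μ ε τ < (s : EReal)) :
    ∃ (F : Finset E) (S : Set E), (F.card : ℝ) ≤ ε ^ (-s) ∧ μ Sᶜ ≤ ENNReal.ofReal τ ∧
      ∀ x ∈ S, ∃ c ∈ F, dist x c ≤ ε := by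
  have hlog : 0 < -Real.log ε := neg_pos.2 (Real.log_neg hε0 hε1)
  have hN : (measureCoveringNumber μ ε τ : ℝ≥0∞) < ENNReal.ofReal (ε ^ (-s)) := by
    rw [measureCoveringDim, EReal.div_lt_iff (by exact_mod_cast hlog) (EReal.coe_ne_top _)] at h
    rw [← ENNReal.log_lt_log_iff, ENNReal.log_ofReal_of_pos (by positivity), Real.log_rpow hε0]
    refine h.trans_eq ?_
    rw [← EReal.coe_mul]
    congr 1
    ring
  have hNtop : measureCoveringNumber μ ε τ ≠ ⊤ := by
    intro h
    rw [h] at hN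
    simp at hN
  have hlt : measureCoveringNumber μ ε τ < measureCoveringNumber μ ε τ + 1 :=
    (ENat.lt_add_one_iff hNtop).2 le_rfl
  conv_lhs at hlt => rw [measureCoveringNumber]
  simp only [iInf_lt_iff] at hlt
  obtain ⟨S, hS, hμS, hlt⟩ := hlt
  rw [ENat.lt_add_one_iff hNtop, ballCoveringNumber] at hlt
  obtain ⟨C, hC, hCcard⟩ : ∃ C : Set E, Metric.IsCover (ε / 2).toNNReal S C ∧
      C.encard ≤ measureCoveringNumber μ ε τ := by
    have h1 : Metric.externalCoveringNumber (ε / 2).toNNReal S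
        < measureCoveringNumber μ ε τ + 1 := (ENat.lt_add_one_iff hNtop).2 hlt
    simp only [Metric.externalCoveringNumber, iInf_lt_iff] at h1
    obtain ⟨C, hC, h1⟩ := h1
    exact ⟨C, hC, (ENat.lt_add_one_iff hNtop).1 h1⟩
  have hCfin : C.Finite := Set.encard_lt_top_iff.1 (hCcard.trans_lt (lt_top_iff_ne_top.2 hNtop))
  refine ⟨hCfin.toFinset, S, ?_, ?_, ?_⟩
  · rw [hCfin.encard_eq_coe_toFinset_card] at hCcard
    have h1 : ((hCfin.toFinset.card : ℕ∞) : ℝ≥0∞) ≤ ENNReal.ofReal (ε ^ (-s)) :=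
      (ENat.toENNReal_le.2 hCcard).trans hN.le
    rw [ENat.toENNReal_coe, ← ENNReal.ofReal_natCast,
      ENNReal.ofReal_le_ofReal_iff (by positivity)] at h1
    exact h1
  · rw [prob_compl_eq_one_sub hS, tsub_le_iff_right]
    calc (1 : ℝ≥0∞) = ENNReal.ofReal (τ + (1 - τ)) := by simp
      _ ≤ ENNReal.ofReal τ + ENNReal.ofReal (1 - τ) := ENNReal.ofReal_add_le
      _ ≤ _ := by gcongr
  · intro x hx
    obtain ⟨c, hc, hxc⟩ := hC hx
    refine ⟨c, hCfin.mem_toFinset.2 hc, ?_⟩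
    have h2 : edist x c ≤ ENNReal.ofReal (ε / 2) := hxc
    rw [edist_dist, ENNReal.ofReal_le_ofReal_iff (by positivity)] at h2
    linarith

/-- The rate of convergence of empirical measures in the Wasserstein sense. -/
theorem exists_lintegral_transportCost_le {μ : Measure E} [IsProbabilityMeasure μ] {p s : ℝ}
    (hp : 1 ≤ p) (hs : upperWassersteinDim p μ < (s : EReal)) :
    ∃ C : ℝ, ∀ (Θ : Type*) [MeasurableSpace Θ] (P : Measure Θ) [IsProbabilityMeasure P]
      (Z : ℕ → Θ → E), IsIIDSample P μ Z → ∀ n : ℕ, 1 ≤ n →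
        ∫⁻ θ, transportCost p (empiricalMeasure (fun i => Z i θ) n) μ ∂P
          ≤ ENNReal.ofReal (C * (n : ℝ) ^ (-p / s)) := by
  simp only [upperWassersteinDim, iInf_lt_iff] at hs
  obtain ⟨t, ht, hlim, hts⟩ := hs
  have hts' : t < s := by exact_mod_cast hts
  have hev := eventually_lt_of_limsup_lt (hlim.trans_lt hts)
  obtain ⟨ε₀, hε₀, hev⟩ := mem_nhdsGT_iff_exists_Ioo_subset.1 hev
  rw [Set.mem_Ioi] at hε₀
  -- The mass exponent decreases in `s`, so for `ε < 1` the exceptional mass allowed for `t` is also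
  -- allowed for `s`.
  have hβ : s * p / (s - 2 * p) ≤ t * p / (t - 2 * p) := by
    rw [div_le_div_iff₀ (by linarith) (by linarith)]
    nlinarith [mul_nonneg (by positivity : 0 ≤ p * p) (sub_nonneg.2 hts'.le)]
  have hβ0 : 0 ≤ s * p / (s - 2 * p) :=
    div_nonneg (mul_nonneg (by linarith) (by linarith)) (by linarith)
  have hsmall : ∀ ε : ℝ, 0 < ε → ε < ε₀ → ε < 1 → ∃ (F : Finset E) (S : Set E),
      (F.card : ℝ) ≤ ε ^ (-s) ∧ μ Sᶜ ≤ ENNReal.ofReal (ε ^ (s * p / (s - 2 * p))) ∧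
      ∀ x ∈ S, ∃ c ∈ F, dist x c ≤ ε := by
    intro ε h0 hεε h1
    obtain ⟨F, S, hF, hS, hcov⟩ :=
      exists_cover_of_measureCoveringDim_lt h0 h1 (hev ⟨h0, hεε⟩)
    exact ⟨F, S, hF, hS.trans (ENNReal.ofReal_le_ofReal
      (Real.rpow_le_rpow_of_exponent_ge h0 h1.le hβ)), hcov⟩
  set ε₁ : ℝ := min ε₀ 1 / 2 with hε₁
  have hε₁0 : 0 < ε₁ := by positivity
  have hε₁1 : ε₁ < 1 := by have := min_le_right ε₀ 1; linarith
  have hε₁ε : ε₁ < ε₀ := by have := min_le_left ε₀ 1; linarith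
  have hneg : -s ≤ 0 := by linarith
  have hK₀ : 1 ≤ ε₁ ^ (-s) := Real.one_le_rpow_of_pos_of_le_one_of_nonpos hε₁0 hε₁1.le hneg
  refine exists_lintegral_transportCost_le_of_cover hp (by linarith) hK₀ ?_
  intro ε h0 h1
  have hone : 1 ≤ ε ^ (-s) := Real.one_le_rpow_of_pos_of_le_one_of_nonpos h0 h1 hneg
  rcases lt_or_ge ε ε₁ with h | h
  · obtain ⟨F, S, hF, hS, hcov⟩ := hsmall ε h0 (h.trans hε₁ε) (h.trans hε₁1)
    exact ⟨F, S, hF.trans (le_mul_of_one_le_left (by positivity) hK₀), hS, hcov⟩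
  -- At scales above `ε₁` the cover at scale `ε₁` is reused; the constant `ε₁ ^ (-s)` pays for its
  -- size.
  · obtain ⟨F, S, hF, hS, hcov⟩ := hsmall ε₁ hε₁0 hε₁ε hε₁1
    refine ⟨F, S, hF.trans (le_mul_of_one_le_right (by positivity) hone),
      hS.trans (ENNReal.ofReal_le_ofReal (by gcongr)), fun x hx => ?_⟩
    obtain ⟨c, hc, hxc⟩ := hcov x hx
    exact ⟨c, hc, hxc.trans h⟩

end Rate

/-! ### Measurable dependence on the sample -/

section Measurability

/-- This moves the dependence on the sample out of the set of couplings: index the atoms by the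
uniform measure on `{0, …, n - 1}` and disintegrate. Repeated sample points do no harm, since their
indices share one conditional law. -/
theorem couplings_empiricalMeasure {E F : Type*} [MeasurableSpace E] [MeasurableSpace F]
    [StandardBorelSpace F] [Nonempty F] (z : ℕ → E) {n : ℕ} (hn : 1 ≤ n) (μ : Measure F) :
    couplings (empiricalMeasure z n) μ =
      (fun η => η.map (Prod.map z id)) '' couplings (empiricalMeasure id n : Measure ℕ) μ := by
  have hz : Measurable z := measurable_from_nat
  have hzid : Measurable (Prod.map z (id : F → F)) := hz.prodMap measurable_id
  have := isProbabilityMeasure_empiricalMeasure (id : ℕ → ℕ) hn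
  have hemp : (empiricalMeasure id n).map z = empiricalMeasure z n := empiricalMeasure_map id n hz
  ext π
  constructor
  · rintro ⟨h1, h2⟩
    have hπ : IsProbabilityMeasure π := by
      have := isProbabilityMeasure_empiricalMeasure z hn
      rw [← h1] at this
      exact Measure.isProbabilityMeasure_of_map (f := Prod.fst)
    set κ : Kernel ℕ F := π.condKernel.comap z hz
    have hmap : ((empiricalMeasure id n) ⊗ₘ κ).map (Prod.map z id) = π := by
      conv_rhs => rw [← π.disintegrate π.condKernel]
      rw [show π.fst = (empiricalMeasure id n).map z from h1.trans hemp.symm]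
      ext s hs
      rw [Measure.map_apply hzid hs, Measure.compProd_apply (hzid hs), Measure.compProd_apply hs,
        lintegral_map (Kernel.measurable_kernel_prodMk_left hs) hz]
      rfl
    refine ⟨(empiricalMeasure id n) ⊗ₘ κ, ⟨Measure.fst_compProd _ _, ?_⟩, hmap⟩
    rw [← h2, ← hmap, Measure.map_map measurable_snd hzid]
    rfl
  · rintro ⟨η, ⟨h1, h2⟩, rfl⟩
    constructor
    · rw [Measure.map_map measurable_fst hzid, ← hemp, ← h1, Measure.map_map hz measurable_fst]
      rfl
    · rw [Measure.map_map measurable_snd hzid, ← h2]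
      rfl

/-- After reindexing, the infimum runs over a fixed set of plans. For each plan the loss is
continuous in `z` by dominated convergence, so the infimum is upper semicontinuous. -/
theorem measurable_iInf_couplings_empiricalMeasure {E : Type*} [MetricSpace E] [CompactSpace E]
    [MeasurableSpace E] [BorelSpace E] {c : (E × E) × (E × E) → ℝ} (hc : Continuous c)
    (μ : Measure E) [IsProbabilityMeasure μ] {n : ℕ} (hn : 1 ≤ n) :
    Measurable fun z : ℕ → E => ⨅ π ∈ couplings (empiricalMeasure z n) μ,
      ∫⁻ w, ENNReal.ofReal (c w) ∂(π.prod π) := by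
  have : Nonempty E := nonempty_of_isProbabilityMeasure μ
  have hfin : ∀ η ∈ couplings (empiricalMeasure id n : Measure ℕ) μ, IsProbabilityMeasure η := by
    rintro η ⟨h1, -⟩
    have := isProbabilityMeasure_empiricalMeasure (id : ℕ → ℕ) hn
    rw [← h1] at this
    exact Measure.isProbabilityMeasure_of_map (f := Prod.fst)
  have hcm : Measurable fun w => ENNReal.ofReal (c w) := hc.measurable.ennreal_ofReal
  have heq (z : ℕ → E) : ⨅ π ∈ couplings (empiricalMeasure z n) μ,
      ∫⁻ w, ENNReal.ofReal (c w) ∂(π.prod π)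
      = ⨅ η ∈ couplings (empiricalMeasure id n : Measure ℕ) μ,
        ∫⁻ w, ENNReal.ofReal (c ((z w.1.1, w.1.2), (z w.2.1, w.2.2))) ∂(η.prod η) := by
    rw [couplings_empiricalMeasure z hn, iInf_image]
    refine iInf_congr fun η => iInf_congr fun hη => ?_
    have := hfin η hη
    have hzid : Measurable (Prod.map z (id : E → E)) := measurable_from_nat.prodMap measurable_id
    rw [Measure.map_prod_map _ _ hzid hzid, lintegral_map hcm (hzid.prodMap hzid)]
    rfl
  simp_rw [heq]
  refine UpperSemicontinuous.measurable (upperSemicontinuous_biInf fun η hη => ?_)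
  have := hfin η hη
  refine Continuous.upperSemicontinuous (continuous_iff_continuousAt.2 fun z₀ => ?_)
  obtain ⟨M, hM⟩ := (isCompact_range hc).bddAbove
  refine tendsto_lintegral_filter_of_dominated_convergence (fun _ => ENNReal.ofReal M)
    (Eventually.of_forall fun z => ?_)
    (Eventually.of_forall fun z => ae_of_all _ fun w =>
      ENNReal.ofReal_le_ofReal (hM ⟨_, rfl⟩)) (by simp) (ae_of_all _ fun w => ?_)
  · have hz : Measurable z := measurable_from_nat
    exact hcm.comp (by fun_prop)
  · exact Continuous.tendsto (f := fun z : ℕ → E =>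
      ENNReal.ofReal (c ((z w.1.1, w.1.2), (z w.2.1, w.2.2)))) (ENNReal.continuous_ofReal.comp (by fun_prop)) z₀

end Measurability

/-! ### From the Wasserstein distance to FGW and GW -/

section Comparison

/-- Convexity gives `(a + b) ^ p ≤ 2 ^ (p - 1) * (a ^ p + b ^ p)`, and each term depends on only one
factor of `π.prod π`. -/
theorem lintegral_prod_self_le {E : Type*} [MetricSpace E] [SecondCountableTopology E]
    [MeasurableSpace E] [BorelSpace E] {π : Measure (E × E)} [IsProbabilityMeasure π] {p : ℝ}
    (hp : 1 ≤ p) {f : (E × E) × (E × E) → ℝ≥0∞}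
    (hf : ∀ w, f w ≤ (edist w.1.1 w.1.2 + edist w.2.1 w.2.2) ^ p) :
    ∫⁻ w, f w ∂(π.prod π) ≤ 2 ^ p * ∫⁻ w, edist w.1 w.2 ^ p ∂π := by
  have hm : Measurable fun w : E × E => edist w.1 w.2 ^ p :=
    (measurable_fst.edist measurable_snd).pow_const p
  have hm1 : Measurable fun w : (E × E) × (E × E) => edist w.1.1 w.1.2 ^ p :=
    hm.comp measurable_fst
  have h1 : ∫⁻ w : (E × E) × (E × E), edist w.1.1 w.1.2 ^ p ∂(π.prod π)
      = ∫⁻ w, edist w.1 w.2 ^ p ∂π := by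
    rw [← lintegral_map (f := fun w : E × E => edist w.1 w.2 ^ p) hm measurable_fst,
      Measure.map_fst_prod, measure_univ, one_smul]
  have h2 : ∫⁻ w : (E × E) × (E × E), edist w.2.1 w.2.2 ^ p ∂(π.prod π)
      = ∫⁻ w, edist w.1 w.2 ^ p ∂π := by
    rw [← lintegral_map (f := fun w : E × E => edist w.1 w.2 ^ p) hm measurable_snd,
      Measure.map_snd_prod, measure_univ, one_smul]
  calc ∫⁻ w, f w ∂(π.prod π)
      ≤ ∫⁻ w : (E × E) × (E × E), 2 ^ (p - 1) *
          (edist w.1.1 w.1.2 ^ p + edist w.2.1 w.2.2 ^ p) ∂(π.prod π) :=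
        lintegral_mono fun w => (hf w).trans (ENNReal.rpow_add_le_mul_rpow_add_rpow _ _ hp)
    _ = 2 ^ (p - 1) * (2 * ∫⁻ w, edist w.1 w.2 ^ p ∂π) := by
        rw [lintegral_const_mul' _ _ (by finiteness), lintegral_add_left hm1, h1, h2, two_mul]
    _ = _ := by
        rw [← mul_assoc]
        congr 1
        conv_rhs => rw [show p = (p - 1) + 1 by ring,
          ENNReal.rpow_add _ _ two_ne_zero ENNReal.ofNat_ne_top, ENNReal.rpow_one]

theorem isProbabilityMeasure_of_mem_couplings {E F : Type*} [MeasurableSpace E] [MeasurableSpace F]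
    {μ : Measure E} [hμ : IsProbabilityMeasure μ] {ν : Measure F} {π : Measure (E × F)}
    (hπ : π ∈ couplings μ ν) : IsProbabilityMeasure π := by
  rw [← hπ.1] at hμ
  exact Measure.isProbabilityMeasure_of_map (f := Prod.fst)

theorem abs_dist_sub_dist_le {X : Type*} [MetricSpace X] (x y x' y' : X) :
    |dist x x' - dist y y'| ≤ dist x y + dist x' y' := by
  rw [abs_le]
  constructor
  · linarith [dist_triangle y x y', dist_triangle x x' y', dist_comm x y]
  · linarith [dist_triangle x y x', dist_triangle y y' x', dist_comm x' y']

theorem gwDist_rpow_le {X : Type*} [MetricSpace X] [SecondCountableTopology X] [MeasurableSpace X]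
    [BorelSpace X] {p : ℝ} (hp : 1 ≤ p) (μ ν : Measure X) [IsProbabilityMeasure μ] :
    gwDist p μ ν ^ p ≤ 2 ^ p * transportCost p μ ν := by
  have hp0 : 0 < p := by linarith
  rw [gwDist, ← ENNReal.rpow_mul, one_div_mul_cancel hp0.ne', ENNReal.rpow_one, transportCost]
  simp_rw [ENNReal.mul_iInf_of_ne (by simp : (2 : ℝ≥0∞) ^ p ≠ 0) (by finiteness)]
  refine iInf_mono fun π => iInf_mono fun hπ => ?_
  have := isProbabilityMeasure_of_mem_couplings hπ
  refine lintegral_prod_self_le hp fun w => ?_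
  rw [edist_dist, edist_dist, ← ENNReal.ofReal_add dist_nonneg dist_nonneg,
    ENNReal.ofReal_rpow_of_nonneg (by positivity) hp0.le]
  gcongr
  exact abs_dist_sub_dist_le _ _ _ _

theorem WithLp.prod_dist_one_eq {X Y : Type*} [MetricSpace X] [MetricSpace Y]
    (u v : WithLp 1 (X × Y)) : dist u v = dist u.fst v.fst + dist u.snd v.snd := by
  rw [WithLp.prod_dist_eq_add (by simp)]
  simp

/-- As `α` and `1 - α` are at most `1`, the integrand's base is at most the feature displacement of
the first pair plus the two displacements in `X`, hence at most the sum of the two displacements in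
the sum metric. -/
theorem fgwDist_rpow_le {X Ω : Type*} [MetricSpace X] [SecondCountableTopology X]
    [MeasurableSpace X] [BorelSpace X] [MetricSpace Ω] [SecondCountableTopology Ω]
    [MeasurableSpace Ω] [BorelSpace Ω] {A : Set Ω} {α p : ℝ} (hα0 : 0 ≤ α) (hα1 : α ≤ 1)
    (hp : 1 ≤ p) (μ ν : Measure (X × A)) [IsProbabilityMeasure μ] :
    fgwDist α p 1 μ ν ^ p ≤ 2 ^ p * transportCost p (onSumMetric μ) (onSumMetric ν) := by
  have hp0 : 0 < p := by linarith
  rw [fgwDist, ← ENNReal.rpow_mul, one_div_mul_cancel hp0.ne', ENNReal.rpow_one, transportCost]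
  simp_rw [ENNReal.mul_iInf_of_ne (by simp : (2 : ℝ≥0∞) ^ p ≠ 0) (by finiteness)]
  refine le_iInf₂ fun π hπ => ?_
  have hto : Measurable (WithLp.toLp 1 : X × A → _) := WithLp.measurable_toLp _ _
  have hof : Measurable (WithLp.ofLp : WithLp 1 (X × A) → _) := WithLp.measurable_ofLp _ _
  have : IsProbabilityMeasure (onSumMetric μ) := Measure.isProbabilityMeasure_map hto.aemeasurable
  have := isProbabilityMeasure_of_mem_couplings hπ
  have hoo : Measurable (Prod.map WithLp.ofLp WithLp.ofLp :
      WithLp 1 (X × A) × WithLp 1 (X × A) → _) := hof.prodMap hof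
  have hmem : π.map (Prod.map WithLp.ofLp WithLp.ofLp) ∈ couplings μ ν := by
    have hback (ρ : Measure (X × A)) : (onSumMetric ρ).map WithLp.ofLp = ρ := by
      rw [onSumMetric, Measure.map_map hof hto]
      exact Measure.map_id
    constructor
    · rw [Measure.map_map measurable_fst hoo, ← hback μ, ← hπ.1, Measure.map_map hof measurable_fst]
      rfl
    · rw [Measure.map_map measurable_snd hoo, ← hback ν, ← hπ.2, Measure.map_map hof measurable_snd]
      rfl
  refine (iInf₂_le _ hmem).trans ?_
  rw [fgwLoss, Measure.map_prod_map _ _ hoo hoo]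
  refine (lintegral_map_le _ _).trans (lintegral_prod_self_le hp fun w => ?_)
  rw [edist_dist, edist_dist, ← ENNReal.ofReal_add dist_nonneg dist_nonneg,
    ENNReal.ofReal_rpow_of_nonneg (by positivity) hp0.le]
  have h1α : 0 ≤ 1 - α := by linarith
  simp only [Real.rpow_one]
  refine ENNReal.ofReal_le_ofReal (Real.rpow_le_rpow (by positivity) ?_ hp0.le)
  rw [WithLp.prod_dist_one_eq, WithLp.prod_dist_one_eq]
  have h := abs_dist_sub_dist_le w.1.1.fst w.1.2.fst w.2.1.fst w.2.2.fst
  have h1 : 0 ≤ dist w.1.1.fst w.1.2.fst := dist_nonneg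
  have h2 : 0 ≤ dist w.2.1.fst w.2.2.fst := dist_nonneg
  have h3 : 0 ≤ dist w.1.1.snd w.1.2.snd := dist_nonneg
  have h4 : 0 ≤ dist w.2.1.snd w.2.2.snd := dist_nonneg
  calc (1 - α) * dist w.1.1.snd w.1.2.snd
        + α * |dist w.1.1.fst w.2.1.fst - dist w.1.2.fst w.2.2.fst|
      ≤ 1 * dist w.1.1.snd w.1.2.snd
        + 1 * (dist w.1.1.fst w.1.2.fst + dist w.2.1.fst w.2.2.fst) := by
        gcongr
        linarith
    _ ≤ _ := by linarith

/-- Jensen's inequality passes from a bound on the `p`-th moment to the expectation. -/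
theorem lintegral_le_of_rpow_le {Θ : Type*} [MeasurableSpace Θ] {P : Measure Θ}
    [IsProbabilityMeasure P] {f W : Θ → ℝ≥0∞} (hf : AEMeasurable f P) {p s C : ℝ} (hp : 1 ≤ p)
    {n : ℝ} (hn : 0 < n) (hfW : ∀ θ, f θ ^ p ≤ 2 ^ p * W θ)
    (hW : ∫⁻ θ, W θ ∂P ≤ ENNReal.ofReal (C * n ^ (-p / s))) :
    ∫⁻ θ, f θ ∂P ≤ ENNReal.ofReal (2 * max C 0 ^ (1 / p) * n ^ (-1 / s)) := by
  have hp0 : 0 < p := by linarith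
  have hJ := eLpNorm'_le_eLpNorm'_of_exponent_le one_pos hp P hf.aestronglyMeasurable
  simp only [eLpNorm', enorm_eq_self, ENNReal.rpow_one, div_one] at hJ
  refine hJ.trans ?_
  calc (∫⁻ θ, f θ ^ p ∂P) ^ (1 / p)
      ≤ (2 ^ p * ENNReal.ofReal (C * n ^ (-p / s))) ^ (1 / p) := by
        gcongr
        refine (lintegral_mono hfW).trans ?_
        rw [lintegral_const_mul' _ _ (by finiteness)]
        gcongr
    -- The sign of `C` is not known; the maximum makes its real power well behaved.
    _ ≤ (2 ^ p * ENNReal.ofReal (max C 0 * n ^ (-p / s))) ^ (1 / p) := by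
        gcongr
        exact le_max_left _ _
    _ = _ := by
        rw [ENNReal.mul_rpow_of_nonneg _ _ (by positivity), ← ENNReal.rpow_mul,
          mul_one_div_cancel hp0.ne', ENNReal.rpow_one,
          ENNReal.ofReal_rpow_of_nonneg (by positivity) (by positivity),
          Real.mul_rpow (by positivity) (by positivity), ← Real.rpow_mul hn.le, mul_assoc,
          ENNReal.ofReal_mul zero_le_two, ENNReal.ofReal_ofNat]
        congr 4
        field_simp

end Comparison

/-! ### Measurability of the two distances -/

section Measurable

variable {Θ : Type*} [MeasurableSpace Θ] {P : Measure Θ}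

theorem IsIIDSample.measurable_gwDist {X : Type*} [MetricSpace X] [CompactSpace X]
    [MeasurableSpace X] [BorelSpace X] {p : ℝ} (hp : 0 ≤ p) {ν : Measure X}
    [IsProbabilityMeasure ν] {Z : ℕ → Θ → X} (hZ : IsIIDSample P ν Z) {n : ℕ} (hn : 1 ≤ n) :
    Measurable fun θ => gwDist p (empiricalMeasure (fun i => Z i θ) n) ν := by
  have hc : Continuous fun w : (X × X) × (X × X) =>
      |dist w.1.1 w.2.1 - dist w.1.2 w.2.2| ^ p :=
    Continuous.rpow_const (by fun_prop) fun _ => Or.inr hp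
  exact ((measurable_iInf_couplings_empiricalMeasure hc ν hn).comp
    (measurable_pi_lambda _ hZ.measurable)).pow_const _

theorem IsIIDSample.measurable_fgwDist {X Ω : Type*} [MetricSpace X] [CompactSpace X]
    [MeasurableSpace X] [BorelSpace X] [MetricSpace Ω] [MeasurableSpace Ω] [BorelSpace Ω]
    {A : Set Ω} [CompactSpace A] {α p : ℝ} (hp : 0 ≤ p) {μ : Measure (X × A)}
    [IsProbabilityMeasure μ] {Z : ℕ → Θ → X × A} (hZ : IsIIDSample P μ Z) {n : ℕ} (hn : 1 ≤ n) :
    Measurable fun θ => fgwDist α p 1 (empiricalMeasure (fun i => Z i θ) n) μ := by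
  have hc : Continuous fun w : ((X × A) × (X × A)) × ((X × A) × (X × A)) =>
      ((1 - α) * dist (w.1.1.2 : Ω) (w.1.2.2 : Ω) ^ (1 : ℝ)
        + α * |dist w.1.1.1 w.2.1.1 - dist w.1.2.1 w.2.2.1| ^ (1 : ℝ)) ^ p := by
    refine Continuous.rpow_const ?_ fun _ => Or.inr hp
    simp only [Real.rpow_one]
    fun_prop
  exact ((measurable_iInf_couplings_empiricalMeasure hc μ hn).comp
    (measurable_pi_lambda _ hZ.measurable)).pow_const _

end Measurable

end

/-- Convergence of the empirical measures of a structured object in the Fused Gromov-Wasserstein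
sense, rate of convergence in expectation, and the Gromov-Wasserstein rate. -/
theorem proposition2
    {X Ω : Type*}
    [MetricSpace X] [CompactSpace X] [MeasurableSpace X] [BorelSpace X]
    [MetricSpace Ω] [PolishSpace Ω] [MeasurableSpace Ω] [BorelSpace Ω]
    (A : Set Ω) (hA : IsCompact A)
    (μ : Measure (X × A)) [IsProbabilityMeasure μ] [μ.IsOpenPosMeasure]
    (α p : ℝ) (hα0 : 0 ≤ α) (hα1 : α ≤ 1) (hp : 1 ≤ p) :
    (∀ (Θ : Type*) [MeasurableSpace Θ] (P : Measure Θ) [IsProbabilityMeasure P]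
        (Z : ℕ → Θ → X × A), IsIIDSample P μ Z →
        ∀ᵐ θ ∂P, Tendsto
          (fun n : ℕ => fgwDist α p 1 (empiricalMeasure (fun i => Z i θ) n) μ) atTop (𝓝 0)) ∧
    (∀ s : ℝ, upperWassersteinDim p (onSumMetric μ) < (s : EReal) →
      ∃ C : ℝ, ∀ (Θ : Type*) [MeasurableSpace Θ] (P : Measure Θ) [IsProbabilityMeasure P]
        (Z : ℕ → Θ → X × A), IsIIDSample P μ Z → ∀ n : ℕ, 1 ≤ n →
          AEMeasurable (fun θ => fgwDist α p 1 (empiricalMeasure (fun i => Z i θ) n) μ) P ∧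
          ∫⁻ θ, fgwDist α p 1 (empiricalMeasure (fun i => Z i θ) n) μ ∂P
            ≤ ENNReal.ofReal (C * (n : ℝ) ^ (-1 / s))) ∧
    (∀ (ν : Measure X) [IsProbabilityMeasure ν] [ν.IsOpenPosMeasure] (s' : ℝ),
      upperWassersteinDim p ν < (s' : EReal) →
      ∃ C : ℝ, ∀ (Θ : Type*) [MeasurableSpace Θ] (P : Measure Θ) [IsProbabilityMeasure P]
        (Z : ℕ → Θ → X), IsIIDSample P ν Z → ∀ n : ℕ, 1 ≤ n →
          AEMeasurable (fun θ => gwDist p (empiricalMeasure (fun i => Z i θ) n) ν) P ∧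
          ∫⁻ θ, gwDist p (empiricalMeasure (fun i => Z i θ) n) ν ∂P
            ≤ ENNReal.ofReal (C * (n : ℝ) ^ (-1 / s'))) := by

  have : CompactSpace A := isCompact_iff_compactSpace.1 hA
  have hp0 : 0 < p := by linarith
  have hto : Measurable (WithLp.toLp 1 : X × A → _) := WithLp.measurable_toLp _ _
  have : CompactSpace (WithLp 1 (X × A)) := (WithLp.homeomorphProd 1 X A).symm.compactSpace
  have : IsProbabilityMeasure (onSumMetric μ) := Measure.isProbabilityMeasure_map hto.aemeasurable
  have hemp (z : ℕ → X × A) (n : ℕ) : onSumMetric (empiricalMeasure z n)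
      = empiricalMeasure (fun i => WithLp.toLp 1 (z i)) n := empiricalMeasure_map z n hto
  refine ⟨?_, ?_, ?_⟩
  · intro Θ _ P _ Z hZ
    filter_upwards [(hZ.comp hto).ae_tendsto_transportCost hp0] with θ hθ
    have h1 : Tendsto (fun n => (2 ^ p * transportCost p
        (empiricalMeasure (fun i => WithLp.toLp 1 (Z i θ)) n) (onSumMetric μ)) ^ (1 / p))
        atTop (𝓝 0) := by
      have h2 := (ENNReal.Tendsto.const_mul hθ (Or.inr (by finiteness : (2 : ℝ≥0∞) ^ p ≠ ⊤)))
      rw [mul_zero] at h2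
      have h3 := (ENNReal.continuous_rpow_const (y := 1 / p)).tendsto 0 |>.comp h2
      rwa [ENNReal.zero_rpow_of_pos (by positivity)] at h3
    refine tendsto_of_tendsto_of_tendsto_of_le_of_le' tendsto_const_nhds h1
      (Eventually.of_forall fun _ => zero_le) ?_
    -- For `n = 0` the empirical measure is zero, not a probability measure, so the comparison
    -- starts at `n = 1`.
    filter_upwards [eventually_ge_atTop 1] with n hn
    have := isProbabilityMeasure_empiricalMeasure (fun i => Z i θ) hn
    rw [one_div, ENNReal.le_rpow_inv_iff hp0, ← hemp]
    exact fgwDist_rpow_le hα0 hα1 hp _ _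
  · intro s hs
    obtain ⟨C, hC⟩ := exists_lintegral_transportCost_le hp hs
    refine ⟨2 * max C 0 ^ (1 / p), fun Θ _ P _ Z hZ n hn => ?_⟩
    have hm := (hZ.measurable_fgwDist (α := α) hp0.le hn).aemeasurable (μ := P)
    refine ⟨hm, lintegral_le_of_rpow_le hm hp (by exact_mod_cast hn) (fun θ => ?_)
      (hC Θ P _ (hZ.comp hto) n hn)⟩
    have := isProbabilityMeasure_empiricalMeasure (fun i => Z i θ) hn
    rw [← hemp]
    exact fgwDist_rpow_le hα0 hα1 hp _ _
  · intro ν _ _ s hs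
    obtain ⟨C, hC⟩ := exists_lintegral_transportCost_le hp hs
    refine ⟨2 * max C 0 ^ (1 / p), fun Θ _ P _ Z hZ n hn => ?_⟩
    have hm := (hZ.measurable_gwDist hp0.le hn).aemeasurable (μ := P)
    refine ⟨hm, lintegral_le_of_rpow_le hm hp (by exact_mod_cast hn) (fun θ => ?_)
      (hC Θ P Z hZ n hn)⟩
    have := isProbabilityMeasure_empiricalMeasure (fun i => Z i θ) hn
    exact gwDist_rpow_le hp _ _
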